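/- Let $C:\mathbb R^N\to\mathbb R$ be twice continuously differentiable and let $\alpha^*\in\mathbb R^N$ be such that the Hessian $\nabla^2C(\alpha^*)$ is positive definite. Let $(\bar\xi_k)_{k\ge 0}$ be a strictly stationary sequence of centred, square integrable $\mathbb R^N$-valued random vectors (the gradient noise) that is $\varphi$-mixing: $|\Pr(A\cap B)-\Pr(A)\Pr(B)|\le \varphi_j\Pr(A)$ for all $k,j\ge0$, $A\in\sigma(\bar\xi_i:i\le k)$, $B\in\sigma(\bar\xi_i:i\ge k+j)$, with $\sum_j\varphi_j^{1/2}<\infty$. Then the series in $$\Sigma=\mathbb E\,\bar\xi_0\bar\xi_0'+\sum_{k=1}^\infty\mathbb E\,\bar\xi_0\bar\xi_k'+\sum_{k=1}^\infty\mathbb E\,\bar\xi_k\bar\xi_0'$$ converge absolutely and $\Sigma$ is positive semidefinite. Consider the diffusion $$du=-\nabla^2C(\alpha^*)\,u\,dt+\Sigma^{1/2}\,dw,\qquad w\text{ a standard $N$-dimensional Brownian motion},\qquad(\ast)$$ where $w$ is a Brownian motion relative to a filtration to which $u$ is adapted. For every such $w$ and every initial value measurable at time $0$ it has a solution. There is exactly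 one matrix $P$ with $$\nabla^2C(\alpha^*)\,P+P\,\nabla^2C(\alpha^*)=\Sigma ,$$ it is symmetric positive semidefinite, and the diffusion $(\ast)$ is stationary with marginal distribution $N(0,P)$ in the following sense: 1. every solution with $u(0)\sim N(0,P)$ is a strictly stationary process, and $u(t)\sim N(0,P)$ for all $t\ge0$; 2. for every solution, whatever the law of $u(0)$, the law of $u(t)$ converges weakly to $N(0,P)$ as $t\to\infty$, and the finite-dimensional distributions of the shifted process $u(\cdot+s)$ converge weakly, as $s\to\infty$, to those of a solution started from $N(0,P)$. -/

import Mathlib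

open MeasureTheory ProbabilityTheory Filter Topology
open scoped NNReal Matrix

/-- The Hessian matrix of `C` at `a`: the entry `(i, j)` is the second partial derivative
`∂ᵢ ∂ⱼ C (a)`. -/
noncomputable def hessianMatrix {N : ℕ} (C : EuclideanSpace ℝ (Fin N) → ℝ)
    (a : EuclideanSpace ℝ (Fin N)) : Matrix (Fin N) (Fin N) ℝ :=
  Matrix.of fun i j =>
    fderiv ℝ (fun x => fderiv ℝ C x (EuclideanSpace.single j 1)) a (EuclideanSpace.single i 1)

/-- A process indexed by `ℕ` or by `ℝ≥0` is (strictly) stationary if each of its time shifts has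
the same law on path space (equivalently, the same finite-dimensional distributions) as the process
itself. -/
def IsStationaryProcess {T Ω E : Type*} [Add T] [MeasurableSpace Ω] [MeasurableSpace E]
    (X : T → Ω → E) (μ : Measure Ω) : Prop :=
  ∀ s : T, IdentDistrib (fun ω t => X (t + s) ω) (fun ω t => X t ω) μ μ

/-- `ξ` is `φ`-mixing with mixing rate `φ`: for every event `A` of the past up to time `k`
and every event `B` of the future from time `k + j` on, `|P(A ∩ B) - P(A) P(B)| ≤ φ j * P(A)`,
that is, `|P(B | A) - P(B)| ≤ φ j` whenever `P(A) > 0`. -/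
def IsPhiMixing {Ω E : Type*} [MeasurableSpace Ω] [MeasurableSpace E]
    (ξ : ℕ → Ω → E) (μ : Measure Ω) (φ : ℕ → ℝ) : Prop :=
  ∀ k j : ℕ, ∀ A B : Set Ω,
    MeasurableSet[⨆ i, ⨆ (_ : i ≤ k), MeasurableSpace.comap (ξ i) inferInstance] A →
    MeasurableSet[⨆ i, ⨆ (_ : k + j ≤ i), MeasurableSpace.comap (ξ i) inferInstance] B →
    |μ.real (A ∩ B) - μ.real A * μ.real B| ≤ φ j * μ.real A

/-- The matrix `E[ξ₀ ξ₀'] + ∑_{k ≥ 1} E[ξ₀ ξₖ'] + ∑_{k ≥ 1} E[ξₖ ξ₀']`. -/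
noncomputable def longRunCovariance {N : ℕ} {Ω : Type*} [MeasurableSpace Ω]
    (ξ : ℕ → Ω → EuclideanSpace ℝ (Fin N)) (μ : Measure Ω) : Matrix (Fin N) (Fin N) ℝ :=
  Matrix.of fun i j =>
    (∫ ω, ξ 0 ω i * ξ 0 ω j ∂μ) + (∑' k : ℕ, ∫ ω, ξ 0 ω i * ξ (k + 1) ω j ∂μ)
      + (∑' k : ℕ, ∫ ω, ξ (k + 1) ω i * ξ 0 ω j ∂μ)

/-- `w` is a standard `N`-dimensional Brownian motion relative to the filtration `ℱ`. -/
structure IsStandardBrownianMotion {N : ℕ} {Ω : Type*} [mΩ : MeasurableSpace Ω] (μ : Measure Ω)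
    (ℱ : Filtration ℝ≥0 mΩ) (w : ℝ≥0 → Ω → EuclideanSpace ℝ (Fin N)) : Prop where
  adapted : Adapted ℱ w
  continuous_paths : ∀ ω, Continuous fun t => w t ω
  start_zero : ∀ᵐ ω ∂μ, w 0 ω = 0
  indep_increment : ∀ s t : ℝ≥0, s ≤ t →
    Indep (MeasurableSpace.comap (fun ω => w t ω - w s ω) inferInstance) (ℱ s) μ
  law_increment : ∀ s t : ℝ≥0, s ≤ t →
    HasLaw (fun ω => w t ω - w s ω) (multivariateGaussian 0 ((t - s : ℝ) • 1)) μ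

/-- `(u, w)` is a (weak) solution, on the filtered probability space `(Ω, ℱ, μ)`, of the stochastic
differential equation `du = -A u dt + S dw` with constant coefficient matrices `A` and `S`: `w` is a
standard Brownian motion, `u` is adapted with almost surely continuous paths, and almost surely, for
all `t`, `u(t) = u(0) - ∫₀ᵗ A u(s) ds + S w(t)`; the stochastic integral of the constant matrix `S`
is `S w(t)`. The initial value `u(0)` is any `ℱ 0`-measurable random vector. -/
structure IsLinearSDESolution {N : ℕ} {Ω : Type*} [mΩ : MeasurableSpace Ω] (μ : Measure Ω)
    (ℱ : Filtration ℝ≥0 mΩ) (A S : Matrix (Fin N) (Fin N) ℝ)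
    (w u : ℝ≥0 → Ω → EuclideanSpace ℝ (Fin N)) : Prop where
  brownian : IsStandardBrownianMotion μ ℱ w
  adapted : Adapted ℱ u
  continuous_paths : ∀ᵐ ω ∂μ, Continuous fun t => u t ω
  equation : ∀ᵐ ω ∂μ, ∀ t : ℝ≥0,
    u t ω = u 0 ω
      - (∫ s in (0 : ℝ)..t, Matrix.toEuclideanCLM (𝕜 := ℝ) A (u s.toNNReal ω))
      + Matrix.toEuclideanCLM (𝕜 := ℝ) S (w t ω)

/-- The positive semidefinite square root of a positive semidefinite real matrix. -/
noncomputable def psdSqrt {N : ℕ} (M : Matrix (Fin N) (Fin N) ℝ) : Matrix (Fin N) (Fin N) ℝ :=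
  open scoped MatrixOrder in CFC.sqrt M

/-! Write `A` for the Hessian and `S` for the square root of `Σ`. The mixing assumption gives the
covariance inequality `|Cov(X, Y)| ≤ 2 √c ‖X‖₂ ‖Y‖₂` for a past `X` and a future `Y` with mixing
coefficient `c` (`abs_covariance_le_of_mixing`), so the autocovariances are summable. The form `xᵀ Σ
x` is the limit of the normalized variances of the partial sums of `x · ξₖ`, hence nonnegative. The
Lyapunov operator `Q ↦ A Q + Q A` is injective because `A` is positive definite, hence bijective,
and its solution inherits symmetry and semidefiniteness from `Σ`.

For the diffusion no stochastic integration theory is needed, because the noise is additive. Pairing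
a path with the backward flow `θ(r) = exp(-(t - r) A) x` and summing by parts shows that `⟪x, u t⟫ -
⟪θ s, u s⟫` is a pathwise limit of sums of Brownian increments with deterministic weights `Sᵀ θ`.
Their Gaussian characteristic functions pass to the limit, with variance `∫ ‖Sᵀ θ‖²`, and the
Lyapunov equation makes the integrand the derivative of `⟪θ, P θ⟫`. This is the transition formula
`IsLinearSDESolution.integral_mul_cexp`, tested against an arbitrary bounded or integrable
functional of the past.

Everything about laws follows from it: iterating it determines the finite-dimensional distributions
from one marginal, `N(0, P)` is invariant, and the decay of the flow gives convergence of the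
marginals. For the shifted process, `u(t) - exp(-t A) u(0)` has a law that does not depend on that
of `u(0)`, and the subtracted term vanishes in the limit. -/

open scoped RealInnerProductSpace

local notation "𝓛" => Matrix.toEuclideanCLM (𝕜 := ℝ)

/-! ### The Lyapunov equation. -/

section Lyapunov

variable {N : ℕ} {A : Matrix (Fin N) (Fin N) ℝ}

/-- The homogeneous Lyapunov equation of a positive definite matrix has only the zero solution. -/
lemma Matrix.PosDef.lyapunov_eq_zero (hA : A.PosDef) {Q : Matrix (Fin N) (Fin N) ℝ}
    (hQ : A * Q + Q * A = 0) : Q = 0 := by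
  -- The equation is multiplied by `Qᵀ` and traced; both resulting terms are nonnegative, so the
  -- first one vanishes.
  have h1 : (Qᵀ * A * Q).trace + (Q * A * Qᵀ).trace = 0 := by
    have : (Q * A * Qᵀ).trace = (Qᵀ * (Q * A)).trace := Matrix.trace_mul_comm _ _
    rw [this, mul_assoc, ← Matrix.trace_add, ← mul_add, hQ, mul_zero, Matrix.trace_zero]
  have h2 : 0 ≤ (Q * A * Qᵀ).trace := by
    have := (hA.posSemidef.mul_mul_conjTranspose_same Q).trace_nonneg
    simpa using this
  have hps : (Qᵀ * A * Q).PosSemidef := by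
    simpa using hA.posSemidef.conjTranspose_mul_mul_same Q
  have h3 : (Qᵀ * A * Q).trace = 0 := le_antisymm (by linarith) hps.trace_nonneg
  have h4 : ∀ i, (Qᵀ * A * Q) i i = 0 := by
    intro i
    exact (Finset.sum_eq_zero_iff_of_nonneg fun i _ => hps.diag_nonneg).1 h3 i (Finset.mem_univ i)
  -- The diagonal entries of `Qᵀ A Q` are the values of the form of `A` at the columns of `Q`.
  have h5 : ∀ i, (fun j => Q j i) = 0 := by
    intro i
    by_contra hne
    have := hA.dotProduct_mulVec_pos hne
    have h6 := h4 i
    rw [mul_assoc, Matrix.mul_apply] at h6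
    simp only [Matrix.transpose_apply, Matrix.mul_apply] at h6
    simp only [dotProduct, Matrix.mulVec, Pi.star_apply, star_trivial] at this
    exact this.ne' h6
  ext j i
  exact congrFun (h5 i) j

/-- The Lyapunov equation of a positive definite matrix is solvable for every right-hand side. -/
lemma Matrix.PosDef.exists_lyapunov (hA : A.PosDef) (M : Matrix (Fin N) (Fin N) ℝ) :
    ∃ P, A * P + P * A = M := by
  have hinj : Function.Injective (LinearMap.mulLeft ℝ A + LinearMap.mulRight ℝ A) := by
    rw [← LinearMap.ker_eq_bot, LinearMap.ker_eq_bot']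
    intro Q hQ
    exact hA.lyapunov_eq_zero (by simpa using hQ)
  obtain ⟨P, hP⟩ := LinearMap.injective_iff_surjective.1 hinj M
  exact ⟨P, by simpa using hP⟩

lemma Matrix.PosDef.lyapunov_unique (hA : A.PosDef) {P Q M : Matrix (Fin N) (Fin N) ℝ}
    (hP : A * P + P * A = M) (hQ : A * Q + Q * A = M) : Q = P := by
  rw [← sub_eq_zero]
  apply hA.lyapunov_eq_zero
  rw [mul_sub, sub_mul, sub_add_sub_comm, hP, hQ, sub_self]

/-- For a positive semidefinite right-hand side, the solution of the Lyapunov equation is positive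
semidefinite. -/
lemma Matrix.PosDef.lyapunov_posSemidef (hA : A.PosDef) {P M : Matrix (Fin N) (Fin N) ℝ}
    (hM : M.PosSemidef) (hP : A * P + P * A = M) : P.PosSemidef := by
  have hAt : Aᵀ = A := by simpa using hA.isHermitian.eq
  have hMt : Mᵀ = M := by simpa using hM.isHermitian.eq
  have hPt : Pᵀ = P := by
    -- Transposing the equation shows that `Pᵀ` solves it too, so symmetry follows from uniqueness.
    refine hA.lyapunov_unique hP ?_
    rw [← hMt, ← hP, Matrix.transpose_add, Matrix.transpose_mul, Matrix.transpose_mul, hAt,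
      add_comm]
  have hherm : P.IsHermitian := by simpa [Matrix.IsHermitian] using hPt
  rw [hherm.posSemidef_iff_eigenvalues_nonneg]
  intro i
  set v : Fin N → ℝ := (hherm.eigenvectorBasis i).ofLp with hv
  have hPv : P *ᵥ v = hherm.eigenvalues i • v := hherm.mulVec_eigenvectorBasis i
  have hv0 : v ≠ 0 := by
    intro h0
    have : hherm.eigenvectorBasis i = 0 := by ext j; exact congrFun h0 j
    exact hherm.eigenvectorBasis.toBasis.ne_zero i (by simpa using this)
  have hpos := hA.dotProduct_mulVec_pos hv0
  have hnn := hM.dotProduct_mulVec_nonneg v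
  -- Tested on an eigenvector of `P`, the equation ties the sign of the eigenvalue to the forms of
  -- `M` and `A`.
  have hcomp : v ⬝ᵥ (M *ᵥ v) = 2 * hherm.eigenvalues i * (v ⬝ᵥ (A *ᵥ v)) := by
    rw [← hP, Matrix.add_mulVec, dotProduct_add, ← Matrix.mulVec_mulVec, ← Matrix.mulVec_mulVec,
      hPv, Matrix.mulVec_smul, dotProduct_smul, Matrix.dotProduct_mulVec v P,
      ← Matrix.mulVec_transpose, hPt, hPv, smul_dotProduct, smul_eq_mul]
    ring
  simp only [star_trivial] at hpos hnn
  rw [hcomp] at hnn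
  simp only [Pi.zero_apply]
  by_contra hneg
  push Not at hneg
  nlinarith

end Lyapunov

/-! ### The exponential flow of a symmetric matrix. -/

section Flow

variable {N : ℕ} {A : Matrix (Fin N) (Fin N) ℝ}

/-- The quadratic-form pairing with a matrix can be moved to the transpose. -/
lemma inner_toEuclideanCLM_eq_inner_transpose (B : Matrix (Fin N) (Fin N) ℝ)
    (x y : EuclideanSpace ℝ (Fin N)) : ⟪x, 𝓛 B y⟫ = ⟪𝓛 Bᵀ x, y⟫ := by
  rw [Matrix.inner_toEuclideanCLM, real_inner_comm, Matrix.inner_toEuclideanCLM,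
    Matrix.dotProduct_mulVec, ← Matrix.mulVec_transpose, dotProduct_comm]

/-- The flow `exp (-t A) x` of the linear equation `x' = -A x` of a symmetric matrix `A`, written
in an eigenbasis of `A`. -/
noncomputable def decayFlow (hA : A.IsHermitian) (t : ℝ) (x : EuclideanSpace ℝ (Fin N)) :
    EuclideanSpace ℝ (Fin N) :=
  ∑ i, (Real.exp (-(hA.eigenvalues i * t)) * ⟪hA.eigenvectorBasis i, x⟫) • hA.eigenvectorBasis i

lemma toEuclideanCLM_eigenvectorBasis (hA : A.IsHermitian) (i : Fin N) :
    𝓛 A (hA.eigenvectorBasis i) = hA.eigenvalues i • hA.eigenvectorBasis i := by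
  ext j
  rw [Matrix.ofLp_toEuclideanCLM, hA.mulVec_eigenvectorBasis i]
  rfl

lemma decayFlow_zero (hA : A.IsHermitian) (x : EuclideanSpace ℝ (Fin N)) :
    decayFlow hA 0 x = x := by
  simpa [decayFlow] using hA.eigenvectorBasis.sum_repr' x

lemma toEuclideanCLM_decayFlow (hA : A.IsHermitian) (t : ℝ) (x : EuclideanSpace ℝ (Fin N)) :
    𝓛 A (decayFlow hA t x) =
      ∑ i, (hA.eigenvalues i * (Real.exp (-(hA.eigenvalues i * t)) *
        ⟪hA.eigenvectorBasis i, x⟫)) • hA.eigenvectorBasis i := by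
  simp only [decayFlow, map_sum, map_smul, toEuclideanCLM_eigenvectorBasis hA, smul_smul]
  refine Finset.sum_congr rfl fun i _ => ?_
  congr 1
  ring

lemma hasDerivAt_decayFlow (hA : A.IsHermitian) (x : EuclideanSpace ℝ (Fin N)) (t : ℝ) :
    HasDerivAt (fun t => decayFlow hA t x) (-(𝓛 A (decayFlow hA t x))) t := by
  rw [toEuclideanCLM_decayFlow, ← Finset.sum_neg_distrib]
  refine HasDerivAt.fun_sum fun i _ => ?_
  have h1 : HasDerivAt (fun t => -(hA.eigenvalues i * t)) (-(hA.eigenvalues i * 1)) t :=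
    ((hasDerivAt_id t).const_mul _).neg
  have h2 := ((h1.exp.mul_const ⟪hA.eigenvectorBasis i, x⟫).smul_const (hA.eigenvectorBasis i))
  convert! h2 using 1
  rw [← neg_smul]
  congr 1
  ring

lemma continuous_decayFlow (hA : A.IsHermitian) :
    Continuous fun p : ℝ × EuclideanSpace ℝ (Fin N) => decayFlow hA p.1 p.2 := by
  unfold decayFlow
  fun_prop

lemma tendsto_decayFlow (hA : A.PosDef) (x : EuclideanSpace ℝ (Fin N)) :
    Tendsto (fun t => decayFlow hA.isHermitian t x) atTop (𝓝 0) := by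
  have : (0 : EuclideanSpace ℝ (Fin N)) =
      ∑ i, (0 * ⟪hA.isHermitian.eigenvectorBasis i, x⟫) • hA.isHermitian.eigenvectorBasis i := by
    simp
  rw [this]
  refine tendsto_finsetSum _ fun i _ => Tendsto.smul_const (Tendsto.mul_const _ ?_) _
  exact Real.tendsto_exp_neg_atTop_nhds_zero.comp
    (tendsto_id.const_mul_atTop (hA.eigenvalues_pos i))

/-- Along the backward flow, `r ↦ ⟪θ r, P θ r⟫` integrates the dissipation of the Lyapunov
equation. -/
lemma integral_norm_sq_decayFlow (hA : A.IsHermitian) {S P : Matrix (Fin N) (Fin N) ℝ}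
    (hP : A * P + P * A = S * Sᵀ) (s t : ℝ) (x : EuclideanSpace ℝ (Fin N)) :
    ∫ r in s..t, ‖𝓛 Sᵀ (decayFlow hA (t - r) x)‖ ^ 2 =
      ⟪x, 𝓛 P x⟫ - ⟪decayFlow hA (t - s) x, 𝓛 P (decayFlow hA (t - s) x)⟫ := by
  have hAt : Aᵀ = A := by simpa using hA.eq
  have hd : ∀ r, HasDerivAt (fun r => decayFlow hA (t - r) x)
      (𝓛 A (decayFlow hA (t - r) x)) r := by
    intro r
    have h1 : HasDerivAt (fun r => t - r) (-1) r := by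
      simpa using (hasDerivAt_id r).const_sub t
    have h2 := (hasDerivAt_decayFlow hA x (t - r)).scomp r h1
    simpa [Function.comp_def] using h2
  -- Backward in time `θ' = A θ`, so the derivative of `⟪θ, P θ⟫` is `⟪θ, (A P + P A) θ⟫ = ‖Sᵀ θ‖²`.
  have hd2 : ∀ r ∈ Set.uIcc s t, HasDerivAt
      (fun r => ⟪decayFlow hA (t - r) x, 𝓛 P (decayFlow hA (t - r) x)⟫)
      (‖𝓛 Sᵀ (decayFlow hA (t - r) x)‖ ^ 2) r := by
    intro r _
    have h3 := (hd r).inner ℝ ((𝓛 P).hasFDerivAt.comp_hasDerivAt r (hd r))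
    convert! h3 using 1
    set y := decayFlow hA (t - r) x
    have e1 : ‖𝓛 Sᵀ y‖ ^ 2 = ⟪y, 𝓛 (S * Sᵀ) y⟫ := by
      rw [← real_inner_self_eq_norm_sq, map_mul, mul_apply_eq_comp,
        inner_toEuclideanCLM_eq_inner_transpose S]
    have e2 : ⟪𝓛 A y, 𝓛 P y⟫ = ⟪y, 𝓛 A (𝓛 P y)⟫ := by
      rw [inner_toEuclideanCLM_eq_inner_transpose A, hAt]
    simp only [Function.comp_def]
    change _ = ⟪y, 𝓛 P (𝓛 A y)⟫ + ⟪𝓛 A y, 𝓛 P y⟫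
    rw [e1, ← hP, e2, map_add, map_mul, map_mul, add_apply, inner_add_right,
      add_comm]
    rfl
  have hc : Continuous fun r => ‖𝓛 Sᵀ (decayFlow hA (t - r) x)‖ ^ 2 := by
    have : Continuous fun r => decayFlow hA (t - r) x :=
      (continuous_decayFlow hA).comp (by fun_prop : Continuous fun r : ℝ => (t - r, x))
    fun_prop
  rw [intervalIntegral.integral_eq_sub_of_hasDerivAt hd2 (hc.intervalIntegrable _ _), sub_self,
    decayFlow_zero]

end Flow

/-! ### Uniform partitions and discretization errors. -/

section RiemannSums

/-- The points of the partition of `[s, t]` into `n` intervals of equal length. -/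
noncomputable def uniformPartition (s t : ℝ≥0) (n k : ℕ) : ℝ≥0 := s + k * ((t - s) / n)

lemma coe_uniformPartition {s t : ℝ≥0} (hst : s ≤ t) (n k : ℕ) :
    (uniformPartition s t n k : ℝ) = s + k * (((t : ℝ) - s) / n) := by
  simp [uniformPartition, NNReal.coe_sub hst]

lemma uniformPartition_zero (s t : ℝ≥0) (n : ℕ) : uniformPartition s t n 0 = s := by
  simp [uniformPartition]

lemma uniformPartition_self {s t : ℝ≥0} (hst : s ≤ t) {n : ℕ} (hn : n ≠ 0) :
    uniformPartition s t n n = t := by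
  have : (n : ℝ≥0) ≠ 0 := by exact_mod_cast hn
  rw [uniformPartition, mul_div_cancel₀ _ this, add_tsub_cancel_of_le hst]

lemma monotone_uniformPartition (s t : ℝ≥0) (n : ℕ) : Monotone (uniformPartition s t n) := by
  intro j k hjk
  unfold uniformPartition
  gcongr

lemma uniformPartition_le {s t : ℝ≥0} (hst : s ≤ t) {n k : ℕ} (hn : n ≠ 0) (hk : k ≤ n) :
    uniformPartition s t n k ≤ t :=
  (monotone_uniformPartition s t n hk).trans (uniformPartition_self hst hn).le

/-- Uniform continuity on the cube `[s, t]³` makes the integrand uniformly small once the mesh is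
small, and the interval lengths add up to `t - s`. The two extra arguments of `Φ` are the cell's
endpoints, so both Riemann sum errors and the errors of summation by parts are covered. -/
lemma tendsto_sum_integral_uniformPartition {s t : ℝ≥0} (hst : s ≤ t) {Φ : ℝ × ℝ × ℝ → ℝ}
    (hΦ : Continuous Φ) (hdiag : ∀ r, Φ (r, r, r) = 0) :
    Tendsto (fun n : ℕ => ∑ k ∈ Finset.range n,
      ∫ r in (uniformPartition s t n k : ℝ)..(uniformPartition s t n (k + 1) : ℝ),
        Φ (r, (uniformPartition s t n k : ℝ), (uniformPartition s t n (k + 1) : ℝ)))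
      atTop (𝓝 0) := by
  have hst' : (s : ℝ) ≤ t := by exact_mod_cast hst
  rw [Metric.tendsto_atTop]
  intro ε hε
  set K : Set (ℝ × ℝ × ℝ) := Set.Icc (s : ℝ) t ×ˢ Set.Icc (s : ℝ) t ×ˢ Set.Icc (s : ℝ) t with hK
  have hKc : IsCompact K := isCompact_Icc.prod (isCompact_Icc.prod isCompact_Icc)
  have huc := hKc.uniformContinuousOn_of_continuous hΦ.continuousOn
  rw [Metric.uniformContinuousOn_iff] at huc
  -- The `+ 1` avoids a zero denominator when `s = t` and leaves the total strictly below `ε`.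
  obtain ⟨δ, hδ, huc⟩ := huc (ε / ((t : ℝ) - s + 1)) (by have := sub_nonneg.2 hst'; positivity)
  have hlim : Tendsto (fun n : ℕ => ((t : ℝ) - s) / n) atTop (𝓝 0) :=
    tendsto_const_div_atTop_nhds_zero_nat _
  obtain ⟨n₀, hn₀⟩ := ((hlim.eventually (gt_mem_nhds hδ)).and (eventually_ne_atTop 0)).exists_forall_of_atTop
  refine ⟨n₀, fun n hn => ?_⟩
  obtain ⟨hnδ, hn0⟩ := hn₀ n hn
  have hnpos : (0 : ℝ) < n := by exact_mod_cast Nat.pos_of_ne_zero hn0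
  rw [dist_zero_right]
  have hstep : ∀ k, (uniformPartition s t n (k + 1) : ℝ) - uniformPartition s t n k
      = ((t : ℝ) - s) / n := by
    intro k
    rw [coe_uniformPartition hst, coe_uniformPartition hst]
    push_cast
    ring
  have hterm : ∀ k ∈ Finset.range n,
      ‖∫ r in (uniformPartition s t n k : ℝ)..(uniformPartition s t n (k + 1) : ℝ),
        Φ (r, (uniformPartition s t n k : ℝ), (uniformPartition s t n (k + 1) : ℝ))‖ ≤
      ε / ((t : ℝ) - s + 1) * (((t : ℝ) - s) / n) := by
    intro k hk
    have hk' : k + 1 ≤ n := Finset.mem_range.1 hk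
    set a := uniformPartition s t n k
    set b := uniformPartition s t n (k + 1)
    have hab : (a : ℝ) ≤ b := by exact_mod_cast monotone_uniformPartition s t n (Nat.le_succ k)
    have hsa : (s : ℝ) ≤ a := by
      have := monotone_uniformPartition s t n (Nat.zero_le k)
      rw [uniformPartition_zero] at this
      exact_mod_cast this
    have hbt : (b : ℝ) ≤ t := by exact_mod_cast uniformPartition_le hst hn0 hk'
    refine (intervalIntegral.norm_integral_le_of_norm_le_const (C := ε / ((t : ℝ) - s + 1))
      fun r hr => ?_).trans_eq ?_
    · rw [Set.uIoc_of_le hab] at hr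
      have h1 : (r, (a : ℝ), (b : ℝ)) ∈ K :=
        ⟨⟨by linarith [hr.1], by linarith [hr.2]⟩, ⟨hsa, by linarith⟩, ⟨by linarith, hbt⟩⟩
      have hr' : r ∈ Set.Icc (s : ℝ) t := ⟨by linarith [hr.1], by linarith [hr.2]⟩
      have h2 : (r, r, r) ∈ K := ⟨hr', hr', hr'⟩
      have h3 := hstep k
      have h4 := huc _ h1 _ h2 (by
        simp only [Prod.dist_eq, dist_self, Real.dist_eq]
        refine max_lt hδ (max_lt ?_ ?_) <;> rw [abs_lt] <;> constructor <;>
          linarith [hr.1, hr.2])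
      rw [hdiag, dist_zero_right] at h4
      exact h4.le
    · rw [hstep k, abs_of_nonneg (div_nonneg (sub_nonneg.2 hst') hnpos.le)]
  refine (norm_sum_le_of_le _ hterm).trans_lt ?_
  rw [Finset.sum_const, Finset.card_range, nsmul_eq_mul]
  have hpos : 0 < (t : ℝ) - s + 1 := by linarith
  have : (n : ℝ) * (ε / ((t : ℝ) - s + 1) * (((t : ℝ) - s) / n))
      = ε * (((t : ℝ) - s) / ((t : ℝ) - s + 1)) := by field_simp
  rw [this]
  have h5 : ((t : ℝ) - s) / ((t : ℝ) - s + 1) < 1 := (div_lt_one hpos).2 (by linarith)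
  nlinarith

/-- Riemann sums of a continuous function converge to its integral. -/
lemma tendsto_riemannSum_uniformPartition {s t : ℝ≥0} (hst : s ≤ t) {g : ℝ → ℝ}
    (hg : Continuous g) :
    Tendsto (fun n : ℕ => ∑ k ∈ Finset.range n, g (uniformPartition s t n k) *
      ((uniformPartition s t n (k + 1) : ℝ) - uniformPartition s t n k))
      atTop (𝓝 (∫ r in (s : ℝ)..t, g r)) := by
  have h := tendsto_sum_integral_uniformPartition hst
    (Φ := fun p => g p.1 - g p.2.1) (by fun_prop) (by simp)
  rw [← sub_zero (∫ r in (s : ℝ)..t, g r)]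
  refine (tendsto_const_nhds.sub h).congr' ?_
  filter_upwards [eventually_ne_atTop 0] with n hn
  have hint : ∀ a b : ℝ, IntervalIntegrable g volume a b := fun a b => hg.intervalIntegrable a b
  have hsum := intervalIntegral.sum_integral_adjacent_intervals
    (a := fun k => (uniformPartition s t n k : ℝ)) (n := n) (f := g) (μ := volume)
    fun k _ => hint _ _
  simp only [uniformPartition_zero, uniformPartition_self hst hn] at hsum
  rw [← hsum, ← Finset.sum_sub_distrib]
  refine Finset.sum_congr rfl fun k _ => ?_
  rw [intervalIntegral.integral_sub (hint _ _) (by simp), intervalIntegral.integral_const,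
    smul_eq_mul]
  ring

end RiemannSums

/-! ### Characteristic functions of Brownian increments. -/

section BrownianMotion

variable {N : ℕ} {Ω : Type*} [mΩ : MeasurableSpace Ω] {μ : Measure Ω}
  {ℱ : Filtration ℝ≥0 mΩ} {w u : ℝ≥0 → Ω → EuclideanSpace ℝ (Fin N)}

lemma IsStandardBrownianMotion.measurable (hw : IsStandardBrownianMotion μ ℱ w) (t : ℝ≥0) :
    Measurable (w t) :=
  (hw.adapted t).mono (ℱ.le t) le_rfl

/-- The characteristic function of a Brownian increment, tested against the past. -/
lemma IsStandardBrownianMotion.integral_mul_cexp_increment [IsProbabilityMeasure μ]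
    (hw : IsStandardBrownianMotion μ ℱ w)
    {s t : ℝ≥0} (hst : s ≤ t) (η : EuclideanSpace ℝ (Fin N)) {Z : Ω → ℂ}
    (hZ : Measurable[ℱ s] Z) :
    ∫ ω, Z ω * Complex.exp ((⟪η, w t ω - w s ω⟫ : ℝ) * Complex.I) ∂μ =
      (∫ ω, Z ω ∂μ) * Complex.exp (-((‖η‖ ^ 2 * ((t : ℝ) - s) / 2 : ℝ) : ℂ)) := by
  have hst' : (s : ℝ) ≤ t := by exact_mod_cast hst
  have hmeas : Measurable fun ω => w t ω - w s ω := (hw.measurable t).sub (hw.measurable s)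
  have hf : Measurable fun x : EuclideanSpace ℝ (Fin N) =>
      Complex.exp ((⟪η, x⟫ : ℝ) * Complex.I) := by fun_prop
  have hind : IndepFun Z (fun ω => Complex.exp ((⟪η, w t ω - w s ω⟫ : ℝ) * Complex.I)) μ := by
    rw [IndepFun_iff_Indep]
    refine indep_of_indep_of_le_left (indep_of_indep_of_le_right
      (hw.indep_increment s t hst).symm ?_) hZ.comap_le
    exact (hf.comp (comap_measurable _)).comap_le
  rw [hind.integral_fun_mul_eq_mul_integral
    (hZ.mono (ℱ.le s) le_rfl).aestronglyMeasurable (hf.comp hmeas).aestronglyMeasurable]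
  congr 1
  have hlaw := hw.law_increment s t hst
  have h1 : ∫ ω, Complex.exp ((⟪η, w t ω - w s ω⟫ : ℝ) * Complex.I) ∂μ =
      ∫ x, Complex.exp ((⟪η, x⟫ : ℝ) * Complex.I)
        ∂(multivariateGaussian 0 (((t : ℝ) - s) • (1 : Matrix (Fin N) (Fin N) ℝ))) := by
    rw [← hlaw.map_eq, integral_map hmeas.aemeasurable hf.aestronglyMeasurable]
  rw [h1]
  have h2 := charFun_multivariateGaussian (μ := (0 : EuclideanSpace ℝ (Fin N)))
    ((Matrix.PosSemidef.one (R := ℝ) (n := Fin N)).smul (sub_nonneg.2 hst')) η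
  rw [charFun_apply] at h2
  simp_rw [real_inner_comm] at h2
  rw [h2, inner_zero_right]
  congr 1
  simp only [Complex.ofReal_zero, zero_mul, zero_sub, neg_inj]
  have h3 : η.ofLp ⬝ᵥ η.ofLp = ‖η‖ ^ 2 := by
    rw [EuclideanSpace.real_norm_sq_eq]
    simp [dotProduct, sq]
  simp only [Matrix.smul_mulVec, Matrix.one_mulVec, dotProduct_smul, h3, smul_eq_mul]
  push_cast
  ring

/-- The characteristic function of a linear combination of consecutive Brownian increments, tested
against the past. -/
lemma IsStandardBrownianMotion.integral_mul_cexp_sum [IsProbabilityMeasure μ]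
    (hw : IsStandardBrownianMotion μ ℱ w)
    {τ : ℕ → ℝ≥0} (hτ : Monotone τ) (η : ℕ → EuclideanSpace ℝ (Fin N)) {Z : Ω → ℂ}
    (hZ : Measurable[ℱ (τ 0)] Z) (n : ℕ) :
    ∫ ω, Z ω * Complex.exp
        ((∑ k ∈ Finset.range n, ⟪η k, w (τ (k + 1)) ω - w (τ k) ω⟫ : ℝ) * Complex.I) ∂μ =
      (∫ ω, Z ω ∂μ) * Complex.exp
        (-((∑ k ∈ Finset.range n, ‖η k‖ ^ 2 * ((τ (k + 1) : ℝ) - τ k) / 2 : ℝ) : ℂ)) := by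
  induction n with
  | zero => simp
  | succ n ih =>
    -- The first `n` increments are known at time `τ n`, so they join the test variable and only the
    -- last increment is integrated out.
    have hZ' : Measurable[ℱ (τ n)] fun ω => Z ω * Complex.exp
        ((∑ k ∈ Finset.range n, ⟪η k, w (τ (k + 1)) ω - w (τ k) ω⟫ : ℝ) * Complex.I) := by
      have hZn : Measurable[ℱ (τ n)] Z := hZ.mono (ℱ.mono (hτ (Nat.zero_le n))) le_rfl
      refine hZn.mul (Complex.measurable_exp.comp (Measurable.mul_const ?_ _))
      refine Complex.measurable_ofReal.comp (Finset.measurable_fun_sum _ fun k hk => ?_)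
      have hk : k + 1 ≤ n := Finset.mem_range.1 hk
      have hm1 : Measurable[ℱ (τ n)] (w (τ (k + 1))) :=
        (hw.adapted _).mono (ℱ.mono (hτ hk)) le_rfl
      have hm2 : Measurable[ℱ (τ n)] (w (τ k)) :=
        (hw.adapted _).mono (ℱ.mono (hτ (by omega))) le_rfl
      exact (measurable_const.inner (hm1.sub hm2))
    have h := hw.integral_mul_cexp_increment (hτ (Nat.le_succ n)) (η n) hZ'
    rw [ih] at h
    simp only [Finset.sum_range_succ, Complex.ofReal_add, add_mul, neg_add, Complex.exp_add]
    simp only [← mul_assoc]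
    exact h

end BrownianMotion

/-! ### The transition formula. -/

section Transition

variable {N : ℕ} {A S P : Matrix (Fin N) (Fin N) ℝ}

/-- Along a path that solves the linear equation, the stochastic integral of the backward flow is a
limit of Riemann sums. -/
lemma tendsto_sum_inner_increment (hA : A.IsHermitian) {u w : ℝ≥0 → EuclideanSpace ℝ (Fin N)}
    (hu : Continuous u)
    (heq : ∀ t : ℝ≥0, u t = u 0 - (∫ r in (0 : ℝ)..t, 𝓛 A (u r.toNNReal)) + 𝓛 S (w t))
    {s t : ℝ≥0} (hst : s ≤ t) (x : EuclideanSpace ℝ (Fin N)) :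
    Tendsto (fun n : ℕ => ∑ k ∈ Finset.range n,
      ⟪𝓛 Sᵀ (decayFlow hA (t - uniformPartition s t n k) x),
        w (uniformPartition s t n (k + 1)) - w (uniformPartition s t n k)⟫) atTop
      (𝓝 (⟪x, u t⟫ - ⟪decayFlow hA (t - s) x, u s⟫)) := by
  have hAt : Aᵀ = A := by simpa using hA.eq
  set θ : ℝ → EuclideanSpace ℝ (Fin N) := fun r => decayFlow hA (t - r) x with hθ
  set U : ℝ → EuclideanSpace ℝ (Fin N) := fun r => u r.toNNReal with hU
  have hUc : Continuous U := hu.comp continuous_real_toNNReal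
  have hθc : Continuous θ :=
    (continuous_decayFlow hA).comp (by fun_prop : Continuous fun r : ℝ => ((t : ℝ) - r, x))
  have hUcoe : ∀ a : ℝ≥0, U a = u a := fun a => by simp [hU]
  have hθd : ∀ r, HasDerivAt θ (𝓛 A (θ r)) r := by
    intro r
    have h1 : HasDerivAt (fun r => (t : ℝ) - r) (-1) r := by
      simpa using (hasDerivAt_id r).const_sub (t : ℝ)
    have h2 := (hasDerivAt_decayFlow hA x (t - r)).scomp r h1
    simpa [Function.comp_def] using h2
  have hAU : ∀ a b : ℝ, IntervalIntegrable (fun r => 𝓛 A (U r)) volume a b := fun a b =>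
    ((𝓛 A).continuous.comp hUc).intervalIntegrable a b
  have hAθ : ∀ a b : ℝ, IntervalIntegrable (fun r => 𝓛 A (θ r)) volume a b := fun a b =>
    ((𝓛 A).continuous.comp hθc).intervalIntegrable a b
  have hincr : ∀ a b : ℝ≥0, 𝓛 S (w b - w a) = (U b - U a) + ∫ r in (a : ℝ)..b, 𝓛 A (U r) := by
    intro a b
    have h1 := intervalIntegral.integral_interval_sub_left (hAU 0 b) (hAU 0 a)
    rw [← h1, hUcoe, hUcoe, heq a, heq b, map_sub]
    abel
  -- Summation by parts on one cell: a telescoping difference plus an error integral. At `a = r = b`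
  -- the error integrand vanishes because `A` is symmetric.
  have hterm : ∀ a b : ℝ≥0, ⟪𝓛 Sᵀ (θ a), w b - w a⟫ = (⟪θ b, U b⟫ - ⟪θ a, U a⟫) +
      ∫ r in (a : ℝ)..b, (⟪θ a, 𝓛 A (U r)⟫ - ⟪𝓛 A (θ r), U b⟫) := by
    intro a b
    have h2 : ∫ r in (a : ℝ)..b, 𝓛 A (θ r) = θ b - θ a :=
      intervalIntegral.integral_eq_sub_of_hasDerivAt (fun r _ => hθd r) (hAθ _ _)
    have h3 : ∫ r in (a : ℝ)..b, ⟪θ a, 𝓛 A (U r)⟫ = ⟪θ a, ∫ r in (a : ℝ)..b, 𝓛 A (U r)⟫ :=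
      ((innerSL ℝ (θ a)).intervalIntegral_comp_comm (hAU a b))
    have h4 : ∫ r in (a : ℝ)..b, ⟪𝓛 A (θ r), U b⟫ = ⟪∫ r in (a : ℝ)..b, 𝓛 A (θ r), U b⟫ := by
      simp_rw [real_inner_comm (U b)]
      exact ((innerSL ℝ (U b)).intervalIntegral_comp_comm (hAθ a b))
    rw [intervalIntegral.integral_sub, h3, h4, h2, ← inner_toEuclideanCLM_eq_inner_transpose,
      hincr, inner_add_right, inner_sub_right, inner_sub_left]
    · ring
    · exact Continuous.intervalIntegrable (by fun_prop) _ _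
    · exact Continuous.intervalIntegrable (by fun_prop) _ _
  have hlim := tendsto_sum_integral_uniformPartition hst
    (Φ := fun p => ⟪θ p.2.1, 𝓛 A (U p.1)⟫ - ⟪𝓛 A (θ p.1), U p.2.2⟫) (by fun_prop) (by
      intro r
      simp only
      rw [inner_toEuclideanCLM_eq_inner_transpose, hAt, sub_self])
  have hends : ⟪x, u t⟫ - ⟪decayFlow hA (t - s) x, u s⟫ =
      (⟪θ t, U t⟫ - ⟪θ s, U s⟫) + 0 := by
    simp [hθ, hUcoe, decayFlow_zero]
  rw [hends]
  refine (tendsto_const_nhds.add hlim).congr' ?_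
  filter_upwards [eventually_ne_atTop 0] with n hn
  have htel := Finset.sum_range_sub
    (fun k => ⟪θ (uniformPartition s t n k), U (uniformPartition s t n k)⟫) n
  rw [uniformPartition_zero, uniformPartition_self hst hn] at htel
  rw [← htel, ← Finset.sum_add_distrib]
  exact Finset.sum_congr rfl fun k _ => (hterm _ _).symm

variable {Ω : Type*} [mΩ : MeasurableSpace Ω] {μ : Measure Ω}
  {ℱ : Filtration ℝ≥0 mΩ} {w u : ℝ≥0 → Ω → EuclideanSpace ℝ (Fin N)}

lemma IsLinearSDESolution.measurable (h : IsLinearSDESolution μ ℱ A S w u) (t : ℝ≥0) :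
    Measurable (u t) :=
  (h.adapted t).mono (ℱ.le t) le_rfl

/-- The conditional characteristic function of `u t` given the past up to time `s`. -/
lemma IsLinearSDESolution.integral_mul_cexp [IsProbabilityMeasure μ]
    (h : IsLinearSDESolution μ ℱ A S w u)
    (hA : A.IsHermitian) (hP : A * P + P * A = S * Sᵀ) {s t : ℝ≥0} (hst : s ≤ t)
    (x : EuclideanSpace ℝ (Fin N)) {Z : Ω → ℂ} (hZ : Measurable[ℱ s] Z) (hZi : Integrable Z μ) :
    ∫ ω, Z ω * Complex.exp ((⟪x, u t ω⟫ : ℝ) * Complex.I) ∂μ =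
      (∫ ω, Z ω * Complex.exp ((⟪decayFlow hA (t - s) x, u s ω⟫ : ℝ) * Complex.I) ∂μ) *
        Complex.exp (-(((⟪x, 𝓛 P x⟫ -
          ⟪decayFlow hA (t - s) x, 𝓛 P (decayFlow hA (t - s) x)⟫) / 2 : ℝ) : ℂ)) := by
  set y := decayFlow hA (t - s) x with hy
  set η : ℕ → ℕ → EuclideanSpace ℝ (Fin N) := fun n k =>
    𝓛 Sᵀ (decayFlow hA (t - uniformPartition s t n k) x) with hη
  set Z' : Ω → ℂ := fun ω => Z ω * Complex.exp ((⟪y, u s ω⟫ : ℝ) * Complex.I) with hZ'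
  have hZ'm : Measurable[ℱ s] Z' := by
    refine hZ.mul (Complex.measurable_exp.comp (Measurable.mul_const ?_ _))
    exact Complex.measurable_ofReal.comp (measurable_const.inner (h.adapted s))
  have hnorm : ∀ ω, ‖Z' ω‖ = ‖Z ω‖ := fun ω => by
    simp [hZ', Complex.norm_exp_ofReal_mul_I]
  -- The sums converge along almost every path and the exponentials have modulus one, so `‖Z‖`
  -- dominates.
  have hmain : Tendsto (fun n : ℕ => ∫ ω, Z' ω * Complex.exp ((∑ k ∈ Finset.range n,
      ⟪η n k, w (uniformPartition s t n (k + 1)) ω - w (uniformPartition s t n k) ω⟫ : ℝ)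
        * Complex.I) ∂μ) atTop
      (𝓝 (∫ ω, Z ω * Complex.exp ((⟪x, u t ω⟫ : ℝ) * Complex.I) ∂μ)) := by
    refine tendsto_integral_of_dominated_convergence (fun ω => ‖Z ω‖) (fun n => ?_) hZi.norm
      (fun n => ?_) ?_
    · have hm := hZ'm.mono (ℱ.le s) le_rfl
      refine (hm.mul (Complex.measurable_exp.comp (Measurable.mul_const ?_ _))).aestronglyMeasurable
      refine Complex.measurable_ofReal.comp (Finset.measurable_fun_sum _ fun k _ => ?_)
      exact measurable_const.inner ((h.brownian.measurable _).sub (h.brownian.measurable _))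
    · refine ae_of_all _ fun ω => ?_
      rw [norm_mul, Complex.norm_exp_ofReal_mul_I, mul_one, hnorm]
    · filter_upwards [h.continuous_paths, h.equation] with ω hc heq
      have hl := tendsto_sum_inner_increment hA hc heq hst x
      have hlim : Z ω * Complex.exp ((⟪x, u t ω⟫ : ℝ) * Complex.I) =
          Z' ω * Complex.exp ((⟪x, u t ω⟫ - ⟪y, u s ω⟫ : ℝ) * Complex.I) := by
        simp only [hZ', mul_assoc, ← Complex.exp_add]
        congr 2
        push_cast
        ring
      rw [hlim]
      refine Tendsto.const_mul _ ((Complex.continuous_exp.tendsto _).comp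
        (Tendsto.mul_const _ ?_))
      exact (Complex.continuous_ofReal.tendsto _).comp hl
  refine tendsto_nhds_unique hmain ?_
  have hdisc : ∀ n : ℕ, ∫ ω, Z' ω * Complex.exp ((∑ k ∈ Finset.range n,
      ⟪η n k, w (uniformPartition s t n (k + 1)) ω - w (uniformPartition s t n k) ω⟫ : ℝ)
        * Complex.I) ∂μ = (∫ ω, Z' ω ∂μ) * Complex.exp
        (-((∑ k ∈ Finset.range n, ‖η n k‖ ^ 2 * ((uniformPartition s t n (k + 1) : ℝ) -
          uniformPartition s t n k) / 2 : ℝ) : ℂ)) := fun n =>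
    h.brownian.integral_mul_cexp_sum (monotone_uniformPartition s t n) (η n)
      (by rwa [uniformPartition_zero]) n
  simp_rw [hdisc]
  refine Tendsto.const_mul _ ((Complex.continuous_exp.tendsto _).comp (Tendsto.neg ?_))
  refine (Complex.continuous_ofReal.tendsto _).comp ?_
  -- The limiting variance `∫ ‖Sᵀ θ‖²` is evaluated by the Lyapunov equation.
  rw [hy, ← integral_norm_sq_decayFlow hA hP]
  simp_rw [← Finset.sum_div]
  refine Tendsto.div_const (tendsto_riemannSum_uniformPartition hst
    (g := fun r => ‖𝓛 Sᵀ (decayFlow hA (t - r) x)‖ ^ 2) ?_) _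
  have : Continuous fun r => decayFlow hA (t - r) x :=
    (continuous_decayFlow hA).comp (by fun_prop : Continuous fun r : ℝ => ((t : ℝ) - r, x))
  fun_prop

end Transition

/-! ### Finite-dimensional distributions are determined by one marginal. -/

section UniquenessInLaw

variable {N : ℕ} {A S P : Matrix (Fin N) (Fin N) ℝ}
  {Ω : Type*} [mΩ : MeasurableSpace Ω] {μ : Measure Ω} [IsProbabilityMeasure μ]
  {ℱ : Filtration ℝ≥0 mΩ} {w u : ℝ≥0 → Ω → EuclideanSpace ℝ (Fin N)}
  {Ω' : Type*} [mΩ' : MeasurableSpace Ω'] {μ' : Measure Ω'} [IsProbabilityMeasure μ']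
  {ℱ' : Filtration ℝ≥0 mΩ'} {w' v : ℝ≥0 → Ω' → EuclideanSpace ℝ (Fin N)}

/-- Peeling off the last time from the joint characteristic function of a solution. -/
lemma IsLinearSDESolution.integral_cexp_sum_insert (h : IsLinearSDESolution μ ℱ A S w u)
    (hA : A.IsHermitian) (hP : A * P + P * A = S * Sᵀ) (a : ℝ≥0) {T : Finset ℝ≥0} {m t : ℝ≥0}
    (hT : ∀ r ∈ T, r ≤ m) (hmt : m ≤ t) (ξ : ℝ≥0 → EuclideanSpace ℝ (Fin N))
    (x : EuclideanSpace ℝ (Fin N)) :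
    ∫ ω, Complex.exp ((∑ r ∈ T, ⟪ξ r, u (r + a) ω⟫ + ⟪x, u (t + a) ω⟫ : ℝ) * Complex.I) ∂μ =
      (∫ ω, Complex.exp ((∑ r ∈ T, ⟪ξ r, u (r + a) ω⟫ +
        ⟪decayFlow hA (t - m) x, u (m + a) ω⟫ : ℝ) * Complex.I) ∂μ) *
        Complex.exp (-(((⟪x, 𝓛 P x⟫ -
          ⟪decayFlow hA (t - m) x, 𝓛 P (decayFlow hA (t - m) x)⟫) / 2 : ℝ) : ℂ)) := by
  have hZ : Measurable[ℱ (m + a)] fun ω =>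
      Complex.exp ((∑ r ∈ T, ⟪ξ r, u (r + a) ω⟫ : ℝ) * Complex.I) := by
    refine Complex.measurable_exp.comp (Measurable.mul_const ?_ _)
    refine Complex.measurable_ofReal.comp (Finset.measurable_fun_sum _ fun r hr => ?_)
    have hm1 : Measurable[ℱ (m + a)] (u (r + a)) :=
      (h.adapted _).mono (ℱ.mono (by gcongr; exact hT r hr)) le_rfl
    exact measurable_const.inner hm1
  have hZi : Integrable (fun ω =>
      Complex.exp ((∑ r ∈ T, ⟪ξ r, u (r + a) ω⟫ : ℝ) * Complex.I)) μ :=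
    Integrable.of_bound (hZ.mono (ℱ.le _) le_rfl).aestronglyMeasurable 1
      (ae_of_all _ fun ω => (Complex.norm_exp_ofReal_mul_I _).le)
  have key := h.integral_mul_cexp hA hP (add_le_add_left hmt a) x hZ hZi
  simp only [NNReal.coe_add, add_sub_add_right_eq_sub] at key
  simp only [Complex.ofReal_add, add_mul, Complex.exp_add]
  exact key

/-- Two solutions that have the same law at the times `a` and `b` have, from then on, the same joint
characteristic functions. -/
lemma IsLinearSDESolution.integral_cexp_sum_eq (hu : IsLinearSDESolution μ ℱ A S w u)
    (hv : IsLinearSDESolution μ' ℱ' A S w' v) (hA : A.IsHermitian)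
    (hP : A * P + P * A = S * Sᵀ) {a b : ℝ≥0} (hab : μ.map (u a) = μ'.map (v b))
    (T : Finset ℝ≥0) (ξ : ℝ≥0 → EuclideanSpace ℝ (Fin N)) :
    ∫ ω, Complex.exp ((∑ r ∈ T, ⟪ξ r, u (r + a) ω⟫ : ℝ) * Complex.I) ∂μ =
      ∫ ω, Complex.exp ((∑ r ∈ T, ⟪ξ r, v (r + b) ω⟫ : ℝ) * Complex.I) ∂μ' := by
  induction T using Finset.induction_on_max generalizing ξ with
  | empty => simp
  | insert t T hT ih =>
    have ht : t ∉ T := fun h => lt_irrefl _ (hT t h)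
    have hsplit : ∀ (z : ℝ≥0 → EuclideanSpace ℝ (Fin N)), ∑ r ∈ insert t T, ⟪ξ r, z r⟫ =
        ∑ r ∈ T, ⟪ξ r, z r⟫ + ⟪ξ t, z t⟫ := fun z => by
      rw [Finset.sum_insert ht, add_comm]
    simp only [hsplit (fun r => u (r + a) _), hsplit (fun r => v (r + b) _)]
    rcases T.eq_empty_or_nonempty with rfl | hne
    -- With no earlier time left, peeling goes down to time `0` of the shifted processes, where the
    -- laws agree by hypothesis.
    · rw [hu.integral_cexp_sum_insert hA hP a (m := 0) (by simp) zero_le,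
        hv.integral_cexp_sum_insert hA hP b (m := 0) (by simp) zero_le]
      congr 1
      set y := decayFlow hA (t - (0 : ℝ≥0)) (ξ t)
      have hf : Measurable fun x : EuclideanSpace ℝ (Fin N) =>
        Complex.exp ((⟪y, x⟫ : ℝ) * Complex.I) := by fun_prop
      simp only [Finset.sum_empty, zero_add]
      rw [← integral_map (hu.measurable a).aemeasurable hf.aestronglyMeasurable,
        ← integral_map (hv.measurable b).aemeasurable hf.aestronglyMeasurable, hab]
    · have hmem := T.max'_mem hne
      set m := T.max' hne with hm
      have hle : ∀ r ∈ T, r ≤ m := fun r hr => T.le_max' r hr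
      rw [hu.integral_cexp_sum_insert hA hP a hle (hT m hmem).le,
        hv.integral_cexp_sum_insert hA hP b hle (hT m hmem).le]
      congr 1
      set y := decayFlow hA (t - m) (ξ t)
      -- Peeling off `t` leaves an extra weight `y` at `m`, which is absorbed into `ξ m`; this is
      -- why the induction runs over all `ξ`.
      have hupd : ∀ (z : ℝ≥0 → EuclideanSpace ℝ (Fin N)),
          ∑ r ∈ T, ⟪ξ r, z r⟫ + ⟪y, z m⟫ =
          ∑ r ∈ T, ⟪Function.update ξ m (ξ m + y) r, z r⟫ := fun z => by
        rw [← Finset.add_sum_erase T _ hmem, ← Finset.add_sum_erase T (fun r =>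
          ⟪Function.update ξ m (ξ m + y) r, z r⟫) hmem, Function.update_self, inner_add_left]
        have : ∑ r ∈ T.erase m, ⟪Function.update ξ m (ξ m + y) r, z r⟫ =
            ∑ r ∈ T.erase m, ⟪ξ r, z r⟫ := Finset.sum_congr rfl fun r hr => by
          rw [Function.update_of_ne (Finset.ne_of_mem_erase hr)]
        rw [this]
        ring
      simp only [hupd (fun r => u (r + a) _), hupd (fun r => v (r + b) _)]
      exact ih _

/-- Uniqueness in law: two solutions that have the same law at the times `a` and `b` have, from
then on, the same finite-dimensional distributions. -/
lemma IsLinearSDESolution.identDistrib_finite (hu : IsLinearSDESolution μ ℱ A S w u)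
    (hv : IsLinearSDESolution μ' ℱ' A S w' v) (hA : A.IsHermitian)
    (hP : A * P + P * A = S * Sᵀ) {a b : ℝ≥0} (hab : μ.map (u a) = μ'.map (v b))
    {ι : Type*} [Fintype ι] (τ : ι → ℝ≥0) :
    IdentDistrib (fun ω i => u (τ i + a) ω) (fun ω i => v (τ i + b) ω) μ μ' := by
  classical
  have hum : Measurable fun ω i => u (τ i + a) ω := measurable_pi_lambda _ fun i => hu.measurable _
  have hvm : Measurable fun ω i => v (τ i + b) ω := measurable_pi_lambda _ fun i => hv.measurable _
  refine ⟨hum.aemeasurable, hvm.aemeasurable, ?_⟩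
  have := Measure.isProbabilityMeasure_map (μ := μ) hum.aemeasurable
  have := Measure.isProbabilityMeasure_map (μ := μ') hvm.aemeasurable
  refine Measure.ext_of_charFunDual (funext fun L => ?_)
  set x : ι → EuclideanSpace ℝ (Fin N) := fun i => (InnerProductSpace.toDual ℝ _).symm
    (L.comp (ContinuousLinearMap.single ℝ (fun _ : ι => EuclideanSpace ℝ (Fin N)) i)) with hx
  have hL : ∀ f : ι → EuclideanSpace ℝ (Fin N), L f = ∑ i, ⟪x i, f i⟫ := by
    intro f
    simp only [hx, InnerProductSpace.toDual_symm_apply]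
    exact (ContinuousLinearMap.sum_comp_single ℝ _ L f).symm
  -- The times `τ i` may coincide, so the weights are collected over the fibres of `τ`.
  have hfib : ∀ z : ℝ≥0 → EuclideanSpace ℝ (Fin N), L (fun i => z (τ i)) =
      ∑ r ∈ Finset.univ.image τ, ⟪∑ i with τ i = r, x i, z r⟫ := by
    intro z
    rw [hL, ← Finset.sum_fiberwise_of_maps_to (t := Finset.univ.image τ) (g := τ)
      (fun i hi => Finset.mem_image_of_mem _ hi)]
    refine Finset.sum_congr rfl fun r _ => ?_
    rw [sum_inner]
    refine Finset.sum_congr rfl fun i hi => ?_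
    rw [(Finset.mem_filter.1 hi).2]
  have hLm : Measurable fun f : ι → EuclideanSpace ℝ (Fin N) => Complex.exp (L f * Complex.I) := by
    fun_prop
  rw [charFunDual_apply, charFunDual_apply,
    integral_map hum.aemeasurable hLm.aestronglyMeasurable,
    integral_map hvm.aemeasurable hLm.aestronglyMeasurable]
  have hfu : ∀ ω, L (fun i => u (τ i + a) ω) = _ := fun ω => hfib (fun r => u (r + a) ω)
  have hfv : ∀ ω, L (fun i => v (τ i + b) ω) = _ := fun ω => hfib (fun r => v (r + b) ω)
  simp only [hfu, hfv]
  exact hu.integral_cexp_sum_eq hv hA hP hab _ _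

end UniquenessInLaw

/-! ### Invariance of the Gaussian law and convergence of the marginals. -/

section Marginals

variable {N : ℕ} {A S P : Matrix (Fin N) (Fin N) ℝ}
  {Ω : Type*} [mΩ : MeasurableSpace Ω] {μ : Measure Ω} [IsProbabilityMeasure μ]
  {ℱ : Filtration ℝ≥0 mΩ} {w u : ℝ≥0 → Ω → EuclideanSpace ℝ (Fin N)}

/-- The transition formula with `s = 0` and `Z = 1`. The initial law enters only through its
characteristic function at a point that decays to `0` when `A` is positive definite. -/
lemma IsLinearSDESolution.charFun_map (h : IsLinearSDESolution μ ℱ A S w u)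
    (hA : A.IsHermitian) (hP : A * P + P * A = S * Sᵀ) (t : ℝ≥0)
    (x : EuclideanSpace ℝ (Fin N)) :
    charFun (μ.map (u t)) x = charFun (μ.map (u 0)) (decayFlow hA t x) *
      Complex.exp (-(((⟪x, 𝓛 P x⟫ - ⟪decayFlow hA t x, 𝓛 P (decayFlow hA t x)⟫) / 2 : ℝ) : ℂ)) := by
  have key := h.integral_mul_cexp hA hP (zero_le (a := t)) x (Z := fun _ => 1) measurable_const
    (integrable_const _)
  have hc : ∀ (r : ℝ≥0) (y : EuclideanSpace ℝ (Fin N)), charFun (μ.map (u r)) y =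
      ∫ ω, Complex.exp ((⟪y, u r ω⟫ : ℝ) * Complex.I) ∂μ := by
    intro r y
    have hf : Measurable fun x : EuclideanSpace ℝ (Fin N) =>
      Complex.exp ((⟪y, x⟫ : ℝ) * Complex.I) := by fun_prop
    rw [charFun_apply, ← integral_map (h.measurable r).aemeasurable hf.aestronglyMeasurable]
    simp_rw [real_inner_comm]
  simpa only [one_mul, NNReal.coe_zero, sub_zero, ← hc] using key

lemma charFun_multivariateGaussian_zero (hPs : P.PosSemidef) (x : EuclideanSpace ℝ (Fin N)) :
    charFun (multivariateGaussian 0 P) x = Complex.exp (-((⟪x, 𝓛 P x⟫ / 2 : ℝ) : ℂ)) := by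
  rw [charFun_multivariateGaussian hPs, inner_zero_right, Matrix.inner_toEuclideanCLM]
  congr 1
  push_cast
  ring

/-- `N(0, P)` is an invariant law. -/
lemma IsLinearSDESolution.hasLaw (h : IsLinearSDESolution μ ℱ A S w u)
    (hA : A.IsHermitian) (hPs : P.PosSemidef) (hP : A * P + P * A = S * Sᵀ)
    (h0 : HasLaw (u 0) (multivariateGaussian 0 P) μ) (t : ℝ≥0) :
    HasLaw (u t) (multivariateGaussian 0 P) μ := by
  refine ⟨(h.measurable t).aemeasurable, ?_⟩
  have := Measure.isProbabilityMeasure_map (μ := μ) (h.measurable t).aemeasurable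
  refine Measure.ext_of_charFun (funext fun x => ?_)
  rw [h.charFun_map hA hP, h0.map_eq, charFun_multivariateGaussian_zero hPs,
    charFun_multivariateGaussian_zero hPs, ← Complex.exp_add]
  congr 1
  push_cast
  ring

/-- A solution started from `N(0, P)` is strictly stationary. -/
lemma IsLinearSDESolution.isStationaryProcess (h : IsLinearSDESolution μ ℱ A S w u)
    (hA : A.IsHermitian) (hPs : P.PosSemidef) (hP : A * P + P * A = S * Sᵀ)
    (h0 : HasLaw (u 0) (multivariateGaussian 0 P) μ) : IsStationaryProcess u μ := by
  intro s
  have hX : AEMeasurable (fun ω t => u (t + s) ω) μ :=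
    (measurable_pi_lambda _ fun t => h.measurable _).aemeasurable
  have hY : AEMeasurable (fun ω t => u t ω) μ :=
    (measurable_pi_lambda _ fun t => h.measurable _).aemeasurable
  refine (identDistrib_iff_forall_finset_identDistrib hX hY).2 fun I => ?_
  have hs : μ.map (u s) = μ.map (u 0) := (h.hasLaw hA hPs hP h0 s).map_eq.trans h0.map_eq.symm
  have := h.identDistrib_finite h hA hP hs (fun i : I => (i : ℝ≥0))
  simpa only [add_zero] using! this

/-- From any initial law, the marginal laws converge to `N(0, P)`. -/
lemma IsLinearSDESolution.tendstoInDistribution (h : IsLinearSDESolution μ ℱ A S w u)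
    (hA : A.PosDef) (hPs : P.PosSemidef) (hP : A * P + P * A = S * Sᵀ) :
    TendstoInDistribution u atTop id (fun _ => μ) (multivariateGaussian 0 P) where
  forall_aemeasurable t := (h.measurable t).aemeasurable
  aemeasurable_limit := aemeasurable_id
  tendsto := by
    -- `atTop` on `ℝ≥0` is countably generated, so Lévy's continuity theorem along sequences
    -- suffices.
    refine tendsto_of_seq_tendsto fun t ht => ?_
    refine ProbabilityMeasure.tendsto_of_tendsto_charFun fun x => ?_
    simp only [ProbabilityMeasure.coe_mk, Measure.map_id, charFun_multivariateGaussian_zero hPs]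
    change Tendsto (fun n => charFun (μ.map (u (t n))) x) atTop _
    have := Measure.isProbabilityMeasure_map (μ := μ) (h.measurable 0).aemeasurable
    have hy : Tendsto (fun n => decayFlow hA.isHermitian (t n) x) atTop (𝓝 0) :=
      (tendsto_decayFlow hA x).comp (NNReal.tendsto_coe_atTop.2 ht)
    have h1 : Tendsto (fun n => charFun (μ.map (u 0)) (decayFlow hA.isHermitian (t n) x)) atTop
        (𝓝 1) := by
      have := (continuous_charFun (μ := μ.map (u 0))).tendsto 0
      rw [charFun_zero, probReal_univ, Complex.ofReal_one] at this
      exact this.comp hy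
    have h2 : Tendsto (fun n => ⟪decayFlow hA.isHermitian (t n) x,
        𝓛 P (decayFlow hA.isHermitian (t n) x)⟫) atTop (𝓝 0) := by
      have := hy.inner (𝕜 := ℝ) (((𝓛 P).continuous.tendsto 0).comp hy)
      simpa using this
    have h3 := h1.mul ((Complex.continuous_exp.tendsto _).comp
      (((Complex.continuous_ofReal.tendsto _).comp
        ((tendsto_const_nhds (x := ⟪x, 𝓛 P x⟫)).sub h2 |>.div_const 2)).neg))
    rw [sub_zero, one_mul] at h3
    exact h3.congr fun n => (h.charFun_map hA.isHermitian hP (t n) x).symm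

end Marginals

/-! ### Removing the initial value, and convergence of the shifts. -/

section Difference

variable {N : ℕ} {A S P : Matrix (Fin N) (Fin N) ℝ}
  {Ω : Type*} [mΩ : MeasurableSpace Ω] {μ : Measure Ω}
  {ℱ : Filtration ℝ≥0 mΩ} {w u : ℝ≥0 → Ω → EuclideanSpace ℝ (Fin N)}

/-- Subtracting the flow of the initial value gives the solution that starts at `0`. -/
lemma IsLinearSDESolution.sub_decayFlow (h : IsLinearSDESolution μ ℱ A S w u)
    (hA : A.IsHermitian) :
    IsLinearSDESolution μ ℱ A S w (fun t ω => u t ω - decayFlow hA t (u 0 ω)) where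
  brownian := h.brownian
  adapted t := by
    have h0 : Measurable[ℱ t] (u 0) := (h.adapted 0).mono (ℱ.mono zero_le) le_rfl
    have hc : Continuous fun x => decayFlow hA t x :=
      (continuous_decayFlow hA).comp (by fun_prop : Continuous fun x => ((t : ℝ), x))
    exact (h.adapted t).sub (hc.measurable.comp h0)
  continuous_paths := by
    filter_upwards [h.continuous_paths] with ω hω
    exact hω.sub ((continuous_decayFlow hA).comp
      (by fun_prop : Continuous fun t : ℝ≥0 => ((t : ℝ), u 0 ω)))
  equation := by
    filter_upwards [h.continuous_paths, h.equation] with ω hc heq t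
    have hfc : Continuous fun r : ℝ => 𝓛 A (decayFlow hA r (u 0 ω)) :=
      (𝓛 A).continuous.comp ((continuous_decayFlow hA).comp
        (by fun_prop : Continuous fun r : ℝ => (r, u 0 ω)))
    have huc : Continuous fun r : ℝ => 𝓛 A (u r.toNNReal ω) :=
      (𝓛 A).continuous.comp (hc.comp continuous_real_toNNReal)
    -- The flow solves the noiseless equation, so subtracting it leaves the noise term unchanged.
    have hflow : ∫ r in (0 : ℝ)..t, -(𝓛 A (decayFlow hA r (u 0 ω))) =
        decayFlow hA t (u 0 ω) - decayFlow hA 0 (u 0 ω) :=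
      intervalIntegral.integral_eq_sub_of_hasDerivAt
        (fun r _ => hasDerivAt_decayFlow hA _ r) (hfc.neg.intervalIntegrable _ _)
    rw [intervalIntegral.integral_neg, decayFlow_zero] at hflow
    have hint : ∫ r in (0 : ℝ)..t, 𝓛 A (u r.toNNReal ω - decayFlow hA r.toNNReal (u 0 ω)) =
        (∫ r in (0 : ℝ)..t, 𝓛 A (u r.toNNReal ω)) -
          ∫ r in (0 : ℝ)..t, 𝓛 A (decayFlow hA r (u 0 ω)) := by
      rw [← intervalIntegral.integral_sub (huc.intervalIntegrable _ _)
        (hfc.intervalIntegrable _ _)]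
      refine intervalIntegral.integral_congr fun r hr => ?_
      rw [Set.uIcc_of_le t.coe_nonneg] at hr
      simp only [map_sub, Real.coe_toNNReal r hr.1]
    rw [hint, heq t, NNReal.coe_zero, decayFlow_zero, sub_self]
    have h5 : decayFlow hA t (u 0 ω) =
        u 0 ω - ∫ r in (0 : ℝ)..t, 𝓛 A (decayFlow hA r (u 0 ω)) := by
      rw [sub_eq_add_neg, hflow]
      abel
    rw [h5]
    abel

variable {Ω' : Type*} [mΩ' : MeasurableSpace Ω'] {μ' : Measure Ω'} [IsProbabilityMeasure μ']
  {ℱ' : Filtration ℝ≥0 mΩ'} {w' v : ℝ≥0 → Ω' → EuclideanSpace ℝ (Fin N)}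

lemma measurable_decayFlow_pi (hA : A.IsHermitian) {η : Ω → EuclideanSpace ℝ (Fin N)}
    (hη : Measurable η) {n : ℕ} (t : Fin n → ℝ≥0) :
    Measurable fun ω (i : Fin n) => decayFlow hA (t i) (η ω) := by
  refine measurable_pi_lambda _ fun i => ?_
  have hc : Continuous fun x => decayFlow hA (t i) x :=
    (continuous_decayFlow hA).comp (by fun_prop : Continuous fun x => ((t i : ℝ), x))
  exact hc.measurable.comp hη

/-- The decay holds for every `ω`, which on a probability space gives convergence in measure without
any moment of `η`. -/
lemma tendstoInMeasure_decayFlow [IsProbabilityMeasure μ] (hA : A.PosDef) {η : Ω → EuclideanSpace ℝ (Fin N)}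
    (hη : Measurable η) {n : ℕ} (τ : Fin n → ℝ≥0) :
    TendstoInMeasure μ (fun (s : ℝ≥0) ω (i : Fin n) =>
      decayFlow hA.isHermitian ((τ i + s : ℝ≥0) : ℝ) (η ω)) atTop 0 := by
  refine fun ε hε => tendsto_of_seq_tendsto fun s hs => ?_
  refine tendstoInMeasure_of_tendsto_ae (f := fun k ω (i : Fin n) =>
      decayFlow hA.isHermitian ((τ i + s k : ℝ≥0) : ℝ) (η ω)) (g := 0) (fun k => ?_)
    (ae_of_all _ fun ω => ?_) ε hε
  · exact (measurable_decayFlow_pi hA.isHermitian hη fun i => τ i + s k).aestronglyMeasurable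
  · refine tendsto_pi_nhds.2 fun i => (tendsto_decayFlow hA (η ω)).comp ?_
    exact NNReal.tendsto_coe_atTop.2 (tendsto_atTop_mono (fun k => le_add_self) hs)

/-- The finite-dimensional distributions of the shifts of any solution converge to those of a
solution started from `N(0, P)`. -/
lemma IsLinearSDESolution.tendstoInDistribution_shift [IsProbabilityMeasure μ]
    (hu : IsLinearSDESolution μ ℱ A S w u) (hv : IsLinearSDESolution μ' ℱ' A S w' v) (hA : A.PosDef) (hPs : P.PosSemidef)
    (hP : A * P + P * A = S * Sᵀ) (h0 : HasLaw (v 0) (multivariateGaussian 0 P) μ')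
    {n : ℕ} (τ : Fin n → ℝ≥0) :
    TendstoInDistribution (fun (s : ℝ≥0) ω (i : Fin n) => u (τ i + s) ω) atTop
      (fun ω i => v (τ i) ω) (fun _ => μ) μ' := by
  have hu0 := hu.measurable 0
  have hv0 := hv.measurable 0
  have hum : ∀ s : ℝ≥0, Measurable fun ω (i : Fin n) => u (τ i + s) ω := fun s =>
    measurable_pi_lambda _ fun i => hu.measurable _
  have hvm : ∀ s : ℝ≥0, Measurable fun ω (i : Fin n) => v (τ i + s) ω := fun s =>
    measurable_pi_lambda _ fun i => hv.measurable _
  set X : ℝ≥0 → Ω → Fin n → EuclideanSpace ℝ (Fin N) := fun s ω i =>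
    u (τ i + s) ω - decayFlow hA.isHermitian ((τ i + s : ℝ≥0) : ℝ) (u 0 ω) with hX
  set Y : ℝ≥0 → Ω' → Fin n → EuclideanSpace ℝ (Fin N) := fun s ω i =>
    v (τ i + s) ω - decayFlow hA.isHermitian ((τ i + s : ℝ≥0) : ℝ) (v 0 ω) with hY
  have hXm : ∀ s, Measurable (X s) := fun s =>
    (hum s).sub (measurable_decayFlow_pi hA.isHermitian hu0 fun i => τ i + s)
  have hYm : ∀ s, Measurable (Y s) := fun s =>
    (hvm s).sub (measurable_decayFlow_pi hA.isHermitian hv0 fun i => τ i + s)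
  have hident : ∀ s, IdentDistrib (X s) (Y s) μ μ' := by
    intro s
    -- Both differences start at `0`, so uniqueness in law applies whatever the laws of `u 0` and `v
    -- 0`.
    have hlaw : μ.map (fun ω => u 0 ω - decayFlow hA.isHermitian ((0 : ℝ≥0) : ℝ) (u 0 ω)) =
        μ'.map (fun ω => v 0 ω - decayFlow hA.isHermitian ((0 : ℝ≥0) : ℝ) (v 0 ω)) := by
      simp [decayFlow_zero]
    have := (hu.sub_decayFlow hA.isHermitian).identDistrib_finite
      (hv.sub_decayFlow hA.isHermitian) hA.isHermitian hP hlaw (fun i => τ i + s)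
    simpa only [add_zero] using this
  have hV : TendstoInDistribution (fun (s : ℝ≥0) ω (i : Fin n) => v (τ i + s) ω) atTop
      (fun ω i => v (τ i) ω) (fun _ => μ') μ' := by
    have hst : ∀ s, IdentDistrib (fun ω (i : Fin n) => v (τ i + s) ω)
        (fun ω (i : Fin n) => v (τ i) ω) μ' μ' := by
      intro s
      have hs : μ'.map (v s) = μ'.map (v 0) :=
        (hv.hasLaw hA.isHermitian hPs hP h0 s).map_eq.trans h0.map_eq.symm
      have := hv.identDistrib_finite hv hA.isHermitian hP hs τ
      simpa only [add_zero] using this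
    exact tendstoInDistribution_of_identDistrib 0
      (fun s => (hst 0).trans (hst s).symm) (hst 0)
  -- Slutsky, used twice: `Y` differs from the stationary shifts of `v` by a vanishing flow term;
  -- the limit passes to `X`, which has the same law, and then from `X` to the shifts of `u`.
  have hYd : TendstoInDistribution Y atTop (fun ω i => v (τ i) ω) (fun _ => μ') μ' := by
    refine tendstoInDistribution_of_tendstoInMeasure_sub Y _ hV ?_ fun s => (hYm s).aemeasurable
    have := tendstoInMeasure_decayFlow (μ := μ') hA hv0 τ
    rw [tendstoInMeasure_iff_norm] at this ⊢
    convert! this using 8 with ε hε s ω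
    simp only [hY, Pi.sub_apply, Pi.zero_apply, sub_zero]
    rw [← norm_neg]
    congr 1
    ext i j
    simp
  have hXd : TendstoInDistribution X atTop (fun ω i => v (τ i) ω) (fun _ => μ) μ' := by
    refine ⟨fun s => (hXm s).aemeasurable, hYd.aemeasurable_limit, ?_⟩
    exact hYd.tendsto.congr fun s => Subtype.ext (hident s).map_eq.symm
  refine tendstoInDistribution_of_tendstoInMeasure_sub _ _ hXd ?_ fun s => (hum s).aemeasurable
  have := tendstoInMeasure_decayFlow (μ := μ) hA hu0 τ
  convert! this using 1
  ext s ω i j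
  simp [hX]

end Difference

/-! ### Pathwise construction of solutions. -/

section Existence

variable {N : ℕ} {A S : Matrix (Fin N) (Fin N) ℝ}

/-- The convolution `∫₀ᵗ exp (-(t - r) A) A g(r) dr`, written in an eigenbasis of `A`. -/
noncomputable def decayConvolution (hA : A.IsHermitian) (g : ℝ → EuclideanSpace ℝ (Fin N))
    (t : ℝ) : EuclideanSpace ℝ (Fin N) :=
  ∑ i, (hA.eigenvalues i * Real.exp (-(hA.eigenvalues i * t)) *
    ∫ r in (0 : ℝ)..t, Real.exp (hA.eigenvalues i * r) * ⟪hA.eigenvectorBasis i, g r⟫) •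
      hA.eigenvectorBasis i

lemma decayConvolution_zero (hA : A.IsHermitian) (g : ℝ → EuclideanSpace ℝ (Fin N)) :
    decayConvolution hA g 0 = 0 := by
  simp [decayConvolution]

lemma hasDerivAt_decayConvolution (hA : A.IsHermitian) {g : ℝ → EuclideanSpace ℝ (Fin N)}
    (hg : Continuous g) (t : ℝ) :
    HasDerivAt (decayConvolution hA g) (𝓛 A (g t - decayConvolution hA g t)) t := by
  have hsum : 𝓛 A (g t - decayConvolution hA g t) =
      ∑ i, (hA.eigenvalues i * (⟪hA.eigenvectorBasis i, g t⟫ -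
        hA.eigenvalues i * Real.exp (-(hA.eigenvalues i * t)) *
        ∫ r in (0 : ℝ)..t, Real.exp (hA.eigenvalues i * r) * ⟪hA.eigenvectorBasis i, g r⟫)) •
          hA.eigenvectorBasis i := by
    conv_lhs => rw [← hA.eigenvectorBasis.sum_repr' (g t)]
    rw [decayConvolution, ← Finset.sum_sub_distrib, map_sum]
    refine Finset.sum_congr rfl fun i _ => ?_
    rw [← sub_smul, map_smul, toEuclideanCLM_eigenvectorBasis, smul_smul, mul_comm]
  rw [hsum]
  refine HasDerivAt.fun_sum fun i _ => HasDerivAt.smul_const ?_ _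
  set l := hA.eigenvalues i
  have hc : Continuous fun r => Real.exp (l * r) * ⟪hA.eigenvectorBasis i, g r⟫ := by fun_prop
  have h1 : HasDerivAt (fun t => ∫ r in (0 : ℝ)..t, Real.exp (l * r) *
      ⟪hA.eigenvectorBasis i, g r⟫) (Real.exp (l * t) * ⟪hA.eigenvectorBasis i, g t⟫) t :=
    intervalIntegral.integral_hasDerivAt_right (hc.intervalIntegrable _ _)
      (hc.stronglyMeasurableAtFilter _ _) hc.continuousAt
  have h2 : HasDerivAt (fun t => l * Real.exp (-(l * t)))
      (l * (Real.exp (-(l * t)) * -(l * 1))) t :=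
    ((((hasDerivAt_id t).const_mul l).neg).exp).const_mul l
  convert! h2.mul h1 using 1
  have h3 : Real.exp (-(l * t)) * Real.exp (l * t) = 1 := by
    rw [← Real.exp_add]
    simp
  linear_combination (-l * ⟪hA.eigenvectorBasis i, g t⟫) * h3

/-- Variation of constants: `g - decayConvolution hA g` solves `u(t) = g(t) - ∫₀ᵗ A u(r) dr`. -/
lemma decayConvolution_eq_integral (hA : A.IsHermitian) {g : ℝ → EuclideanSpace ℝ (Fin N)}
    (hg : Continuous g) (t : ℝ) :
    ∫ r in (0 : ℝ)..t, 𝓛 A (g r - decayConvolution hA g r) = decayConvolution hA g t := by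
  have hc : Continuous (decayConvolution hA g) :=
    continuous_iff_continuousAt.2 fun r => (hasDerivAt_decayConvolution hA hg r).continuousAt
  rw [intervalIntegral.integral_eq_sub_of_hasDerivAt
    (fun r _ => hasDerivAt_decayConvolution hA hg r)
    (((𝓛 A).continuous.comp (hg.sub hc)).intervalIntegrable _ _), decayConvolution_zero, sub_zero]

variable {Ω : Type*}

/-- The time integral of a continuous process over `[0, t]` is measurable with respect to the
values of the process up to time `t`. -/
lemma measurable_integral_of_continuous {m : MeasurableSpace Ω} {g : ℝ → Ω → ℝ}
    (hc : ∀ ω, Continuous fun r => g r ω) (t : ℝ≥0)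
    (hg : ∀ r : ℝ≥0, r ≤ t → Measurable (g r)) :
    Measurable fun ω => ∫ r in (0 : ℝ)..t, g r ω := by
  -- Riemann sums with left endpoints use only values of the process up to time `t`.
  refine measurable_of_tendsto_metrizable (f := fun (n : ℕ) ω => ∑ k ∈ Finset.range n,
    g (uniformPartition 0 t n k) ω *
      ((uniformPartition 0 t n (k + 1) : ℝ) - uniformPartition 0 t n k)) (fun n => ?_) ?_
  · refine Finset.measurable_fun_sum _ fun k hk => Measurable.mul_const (hg _ ?_) _
    have hk := Finset.mem_range.1 hk
    exact uniformPartition_le zero_le (by omega) hk.le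
  · exact tendsto_pi_nhds.2 fun ω => by
      simpa using tendsto_riemannSum_uniformPartition (zero_le (a := t)) (hc ω)

variable [mΩ : MeasurableSpace Ω] {μ : Measure Ω}
  {ℱ : Filtration ℝ≥0 mΩ} {w : ℝ≥0 → Ω → EuclideanSpace ℝ (Fin N)}

/-- The linear equation has a solution for every Brownian motion and every initial value that is
measurable at time `0`. -/
lemma IsStandardBrownianMotion.exists_isLinearSDESolution (hw : IsStandardBrownianMotion μ ℱ w)
    (hA : A.IsHermitian) (S : Matrix (Fin N) (Fin N) ℝ) {η : Ω → EuclideanSpace ℝ (Fin N)}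
    (hη : Measurable[ℱ 0] η) :
    ∃ u : ℝ≥0 → Ω → EuclideanSpace ℝ (Fin N),
      IsLinearSDESolution μ ℱ A S w u ∧ u 0 =ᵐ[μ] η := by
  -- The noise is additive, so the equation reads `u = g - ∫ A u` and is solved for each path by
  -- variation of constants.
  set g : Ω → ℝ → EuclideanSpace ℝ (Fin N) := fun ω r => η ω + 𝓛 S (w r.toNNReal ω) with hg
  have hgc : ∀ ω, Continuous (g ω) := fun ω => continuous_const.add
    ((𝓛 S).continuous.comp ((hw.continuous_paths ω).comp continuous_real_toNNReal))
  have hcc : ∀ ω, Continuous (decayConvolution hA (g ω)) := fun ω =>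
    continuous_iff_continuousAt.2 fun r => (hasDerivAt_decayConvolution hA (hgc ω) r).continuousAt
  have hgm : ∀ r t : ℝ≥0, r ≤ t → Measurable[ℱ t] fun ω => g ω r := by
    intro r t hrt
    have h1 : Measurable[ℱ t] η := hη.mono (ℱ.mono zero_le) le_rfl
    have h2 : Measurable[ℱ t] (w r) := (hw.adapted r).mono (ℱ.mono hrt) le_rfl
    simp only [hg, Real.toNNReal_coe]
    exact h1.add ((𝓛 S).continuous.measurable.comp h2)
  have hstart : ∀ᵐ ω ∂μ, g ω 0 = η ω := by
    filter_upwards [hw.start_zero] with ω hω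
    simp [hg, hω]
  refine ⟨fun t ω => g ω t - decayConvolution hA (g ω) t, ⟨hw, fun t => ?_, ?_, ?_⟩, ?_⟩
  · refine (hgm t t le_rfl).sub (Finset.measurable_fun_sum _ fun i _ =>
      (Measurable.const_mul ?_ _).smul_const _)
    refine measurable_integral_of_continuous (m := ℱ t) (fun ω => ?_) t fun r hr => ?_
    · have := hgc ω
      fun_prop
    · exact (measurable_const.inner (hgm r t hr)).const_mul _
  · exact ae_of_all _ fun ω =>
      ((hgc ω).sub (hcc ω)).comp NNReal.continuous_coe
  · filter_upwards [hstart] with ω hω t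
    have hint : ∫ r in (0 : ℝ)..t, 𝓛 A (g ω r.toNNReal - decayConvolution hA (g ω) r.toNNReal) =
        decayConvolution hA (g ω) t := by
      rw [← decayConvolution_eq_integral hA (hgc ω) t]
      refine intervalIntegral.integral_congr fun r hr => ?_
      rw [Set.uIcc_of_le t.coe_nonneg] at hr
      simp only [Real.coe_toNNReal r hr.1]
    rw [hint, NNReal.coe_zero, decayConvolution_zero, sub_zero, hω]
    simp only [hg, Real.toNNReal_coe]
    abel
  · filter_upwards [hstart] with ω hω
    simp [decayConvolution_zero, hω]

end Existence

/-! ### The covariance inequality under mixing. -/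

section MixingCovariance

/-- Approximation of a measurable function by functions with finitely many values. -/
lemma exists_approx_mem_finset {Ω : Type*} {m : MeasurableSpace Ω} {X : Ω → ℝ} (hX : Measurable X) :
    ∃ Z : ℕ → Ω → ℝ, (∀ n, Measurable (Z n)) ∧ (∀ n, ∃ s : Finset ℝ, ∀ ω, Z n ω ∈ s) ∧
      (∀ n ω, |Z n ω| ≤ 2 * |X ω|) ∧ ∀ ω, Tendsto (fun n => Z n ω) atTop (𝓝 (X ω)) := by
  refine ⟨fun n => SimpleFunc.approxOn X hX Set.univ 0 (Set.mem_univ _) n,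
    fun n => SimpleFunc.measurable _, fun n => ⟨_, fun ω => SimpleFunc.mem_range_self _ ω⟩,
    fun n ω => ?_, fun ω => SimpleFunc.tendsto_approxOn hX _ (by simp)⟩
  have := SimpleFunc.norm_approxOn_zero_le hX (Set.mem_univ (0 : ℝ)) ω n
  simp only [Real.norm_eq_abs] at this
  linarith

variable {Ω : Type*} {m₁ m₂ : MeasurableSpace Ω} [mΩ : MeasurableSpace Ω] {μ : Measure Ω} [IsProbabilityMeasure μ]

/-- The expectation of a function of two random variables with finitely many values. -/
lemma integral_eq_sum_sum_of_mem_finset {X Y : Ω → ℝ} (hX : Measurable X) (hY : Measurable Y)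
    {s t : Finset ℝ} (hs : ∀ ω, X ω ∈ s) (ht : ∀ ω, Y ω ∈ t) (F : ℝ → ℝ → ℝ) :
    ∫ ω, F (X ω) (Y ω) ∂μ =
      ∑ a ∈ s, ∑ b ∈ t, F a b * μ.real (X ⁻¹' {a} ∩ Y ⁻¹' {b}) := by
  have hm : ∀ a b, MeasurableSet (X ⁻¹' {a} ∩ Y ⁻¹' {b}) := fun a b =>
    (hX (measurableSet_singleton a)).inter (hY (measurableSet_singleton b))
  have hpt : ∀ ω, F (X ω) (Y ω) =
      ∑ a ∈ s, ∑ b ∈ t, (X ⁻¹' {a} ∩ Y ⁻¹' {b}).indicator (fun _ => F a b) ω := by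
    intro ω
    rw [Finset.sum_eq_single_of_mem (X ω) (hs ω), Finset.sum_eq_single_of_mem (Y ω) (ht ω)]
    · simp
    · intro b _ hb
      simp [Ne.symm hb]
    · intro a _ ha
      refine Finset.sum_eq_zero fun b _ => ?_
      simp [Ne.symm ha]
  have hint : ∀ a b, Integrable ((X ⁻¹' {a} ∩ Y ⁻¹' {b}).indicator (fun _ => F a b)) μ :=
    fun a b => (integrable_const _).indicator (hm a b)
  simp_rw [hpt]
  rw [integral_finsetSum _ fun a _ => integrable_finsetSum _ fun b _ => hint a b]
  refine Finset.sum_congr rfl fun a _ => ?_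
  rw [integral_finsetSum _ fun b _ => hint a b]
  refine Finset.sum_congr rfl fun b _ => ?_
  rw [integral_indicator_const _ (hm a b), smul_eq_mul, mul_comm]

lemma sum_measureReal_inter_preimage_singleton {Y : Ω → ℝ} (hY : Measurable Y) {A : Set Ω}
    (hA : MeasurableSet A) (t : Finset ℝ) :
    ∑ b ∈ t, μ.real (A ∩ Y ⁻¹' {b}) = μ.real (A ∩ Y ⁻¹' t) := by
  rw [← measureReal_biUnion_finset]
  · congr 1
    ext ω
    simp
  · intro b _ b' _ hbb'
    refine Set.disjoint_left.2 fun ω h1 h2 => hbb' ?_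
    exact h1.2.symm.trans h2.2
  · exact fun b _ => hA.inter (hY (measurableSet_singleton b))

/-- The covariance inequality for random variables with finitely many values. -/
lemma abs_covariance_le_of_mem_finset {c : ℝ} (h₁ : m₁ ≤ mΩ) (h₂ : m₂ ≤ mΩ) (hc : 0 ≤ c)
    (hmix : ∀ A B, MeasurableSet[m₁] A → MeasurableSet[m₂] B →
      |μ.real (A ∩ B) - μ.real A * μ.real B| ≤ c * μ.real A)
    {X Y : Ω → ℝ} (hX : Measurable[m₁] X) (hY : Measurable[m₂] Y)
    {s t : Finset ℝ} (hs : ∀ ω, X ω ∈ s) (ht : ∀ ω, Y ω ∈ t) :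
    |∫ ω, X ω * Y ω ∂μ - (∫ ω, X ω ∂μ) * ∫ ω, Y ω ∂μ| ≤
      2 * √c * (√(∫ ω, X ω ^ 2 ∂μ) * √(∫ ω, Y ω ^ 2 ∂μ)) := by
  have hX' : Measurable X := hX.mono h₁ le_rfl
  have hY' : Measurable Y := hY.mono h₂ le_rfl
  set r : ℝ → ℝ → ℝ := fun a b => μ.real (X ⁻¹' {a} ∩ Y ⁻¹' {b}) with hr
  set p : ℝ → ℝ := fun a => μ.real (X ⁻¹' {a}) with hp
  set q : ℝ → ℝ := fun b => μ.real (Y ⁻¹' {b}) with hq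
  set d : ℝ → ℝ → ℝ := fun a b => r a b - p a * q b with hd
  have hF := integral_eq_sum_sum_of_mem_finset (μ := μ) hX' hY' hs ht
  have hAm : ∀ a, MeasurableSet (X ⁻¹' {a}) := fun a => hX' (measurableSet_singleton a)
  have hBm : ∀ b, MeasurableSet (Y ⁻¹' {b}) := fun b => hY' (measurableSet_singleton b)
  have hXs : X ⁻¹' s = Set.univ := Set.eq_univ_of_forall fun ω => hs ω
  have hYt : Y ⁻¹' t = Set.univ := Set.eq_univ_of_forall fun ω => ht ω
  have hrp : ∀ a, ∑ b ∈ t, r a b = p a := fun a => by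
    simp only [hr, hp]
    rw [sum_measureReal_inter_preimage_singleton hY' (hAm a), hYt, Set.inter_univ]
  have hrq : ∀ b, ∑ a ∈ s, r a b = q b := fun b => by
    simp only [hr, hq]
    simp_rw [Set.inter_comm _ (Y ⁻¹' {b})]
    rw [sum_measureReal_inter_preimage_singleton hX' (hBm b), hXs, Set.inter_univ]
  have hqT : ∀ T : Finset ℝ, ∑ b ∈ T, q b = μ.real (Y ⁻¹' T) := fun T => by
    have := sum_measureReal_inter_preimage_singleton (μ := μ) hY' MeasurableSet.univ T
    simpa only [Set.univ_inter] using this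
  have hp1 : ∑ a ∈ s, p a = 1 := by
    have := sum_measureReal_inter_preimage_singleton (μ := μ) hX' MeasurableSet.univ s
    simpa only [Set.univ_inter, hXs, probReal_univ] using this
  have hr0 : ∀ a b, 0 ≤ r a b := fun a b => measureReal_nonneg
  have hp0 : ∀ a, 0 ≤ p a := fun a => measureReal_nonneg
  have hq0 : ∀ b, 0 ≤ q b := fun b => measureReal_nonneg
  -- Mixing is applied to the whole event `Y ∈ T`, so partial sums are bounded with no loss in the
  -- number of values.
  have hdT : ∀ a, ∀ T : Finset ℝ, |∑ b ∈ T, d a b| ≤ c * p a := by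
    intro a T
    have h := hmix (X ⁻¹' {a}) (Y ⁻¹' T) (hX (measurableSet_singleton a)) (hY T.measurableSet)
    have hsum : ∑ b ∈ T, d a b =
        μ.real (X ⁻¹' {a} ∩ Y ⁻¹' T) - μ.real (X ⁻¹' {a}) * μ.real (Y ⁻¹' T) := by
      simp only [hd]
      rw [Finset.sum_sub_distrib, ← Finset.mul_sum, hqT,
        ← sum_measureReal_inter_preimage_singleton hY' (hAm a)]
    rwa [hsum]
  -- Splitting by the sign of `d a b` costs the factor `2`.
  have hd1 : ∀ a, ∑ b ∈ t, |d a b| ≤ 2 * c * p a := by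
    intro a
    rw [← Finset.sum_filter_add_sum_filter_not t (fun b => 0 ≤ d a b)]
    have e1 : ∑ b ∈ t with 0 ≤ d a b, |d a b| = ∑ b ∈ t with 0 ≤ d a b, d a b :=
      Finset.sum_congr rfl fun b hb => abs_of_nonneg (Finset.mem_filter.1 hb).2
    have e2 : ∑ b ∈ t with ¬ 0 ≤ d a b, |d a b| = -∑ b ∈ t with ¬ 0 ≤ d a b, d a b := by
      rw [← Finset.sum_neg_distrib]
      exact Finset.sum_congr rfl fun b hb =>
        abs_of_nonpos (le_of_lt (not_le.1 (Finset.mem_filter.1 hb).2))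
    rw [e1, e2]
    have f1 := (abs_le.1 (hdT a (t.filter fun b => 0 ≤ d a b))).2
    have f2 := (abs_le.1 (hdT a (t.filter fun b => ¬ 0 ≤ d a b))).1
    linarith
  -- The mixing condition is asymmetric; in this direction the trivial bound is used, which is why
  -- the result carries `√c` and not `c`.
  have hd2 : ∀ b, ∑ a ∈ s, |d a b| ≤ 2 * q b := by
    intro b
    calc ∑ a ∈ s, |d a b| ≤ ∑ a ∈ s, (r a b + p a * q b) := by
          refine Finset.sum_le_sum fun a _ => ?_
          refine (abs_sub _ _).trans_eq ?_
          rw [abs_of_nonneg (hr0 a b), abs_of_nonneg (mul_nonneg (hp0 a) (hq0 b))]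
      _ = 2 * q b := by
          rw [Finset.sum_add_distrib, hrq, ← Finset.sum_mul, hp1]
          ring
  have hcov : ∫ ω, X ω * Y ω ∂μ - (∫ ω, X ω ∂μ) * ∫ ω, Y ω ∂μ =
      ∑ x ∈ s ×ˢ t, x.1 * x.2 * d x.1 x.2 := by
    have e1 : ∫ ω, X ω ∂μ = ∑ a ∈ s, a * p a := by
      rw [hF fun a _ => a]
      exact Finset.sum_congr rfl fun a _ => by rw [← Finset.mul_sum, hrp]
    have e2 : ∫ ω, Y ω ∂μ = ∑ b ∈ t, b * q b := by
      rw [hF fun _ b => b, Finset.sum_comm]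
      exact Finset.sum_congr rfl fun b _ => by rw [← Finset.mul_sum, hrq]
    rw [hF fun a b => a * b, e1, e2, Finset.sum_mul_sum, Finset.sum_product,
      ← Finset.sum_sub_distrib]
    refine Finset.sum_congr rfl fun a _ => ?_
    rw [← Finset.sum_sub_distrib]
    refine Finset.sum_congr rfl fun b _ => ?_
    simp only [hd, hr]
    ring
  have hX2 : ∑ x ∈ s ×ˢ t, x.1 ^ 2 * |d x.1 x.2| ≤ 2 * c * ∫ ω, X ω ^ 2 ∂μ := by
    rw [Finset.sum_product, hF fun a _ => a ^ 2, Finset.mul_sum]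
    refine Finset.sum_le_sum fun a _ => ?_
    simp only
    rw [← Finset.mul_sum, ← Finset.mul_sum, hrp]
    calc a ^ 2 * ∑ b ∈ t, |d a b| ≤ a ^ 2 * (2 * c * p a) :=
          mul_le_mul_of_nonneg_left (hd1 a) (sq_nonneg a)
      _ = 2 * c * (a ^ 2 * p a) := by ring
  have hY2 : ∑ x ∈ s ×ˢ t, x.2 ^ 2 * |d x.1 x.2| ≤ 2 * ∫ ω, Y ω ^ 2 ∂μ := by
    rw [Finset.sum_product_right, hF fun _ b => b ^ 2, Finset.sum_comm (s := s), Finset.mul_sum]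
    refine Finset.sum_le_sum fun b _ => ?_
    simp only
    rw [← Finset.mul_sum, ← Finset.mul_sum, hrq]
    calc b ^ 2 * ∑ a ∈ s, |d a b| ≤ b ^ 2 * (2 * q b) :=
          mul_le_mul_of_nonneg_left (hd2 b) (sq_nonneg b)
      _ = 2 * (b ^ 2 * q b) := by ring
  rw [hcov]
  -- Cauchy–Schwarz with the weights `|d a b|`.
  have hCS : (∑ x ∈ s ×ˢ t, |x.1 * x.2 * d x.1 x.2|) ^ 2 ≤
      (∑ x ∈ s ×ˢ t, x.1 ^ 2 * |d x.1 x.2|) * ∑ x ∈ s ×ˢ t, x.2 ^ 2 * |d x.1 x.2| := by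
    refine Finset.sum_sq_le_sum_mul_sum_of_sq_le_mul _ (fun x _ => by positivity)
      (fun x _ => by positivity) fun x _ => le_of_eq ?_
    rw [abs_mul, mul_pow, sq_abs]
    ring
  have hIX : 0 ≤ ∫ ω, X ω ^ 2 ∂μ := integral_nonneg fun ω => sq_nonneg _
  have hIY : 0 ≤ ∫ ω, Y ω ^ 2 ∂μ := integral_nonneg fun ω => sq_nonneg _
  have hfin : (∑ x ∈ s ×ˢ t, |x.1 * x.2 * d x.1 x.2|) ^ 2 ≤
      (2 * √c * (√(∫ ω, X ω ^ 2 ∂μ) * √(∫ ω, Y ω ^ 2 ∂μ))) ^ 2 := by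
    have e : (2 * √c * (√(∫ ω, X ω ^ 2 ∂μ) * √(∫ ω, Y ω ^ 2 ∂μ))) ^ 2 =
        (2 * c * ∫ ω, X ω ^ 2 ∂μ) * (2 * ∫ ω, Y ω ^ 2 ∂μ) := by
      rw [mul_pow, mul_pow, mul_pow, Real.sq_sqrt hc, Real.sq_sqrt hIX, Real.sq_sqrt hIY]
      ring
    rw [e]
    refine hCS.trans (mul_le_mul hX2 hY2 (Finset.sum_nonneg fun x _ => by positivity)
      (by positivity))
  exact (Finset.abs_sum_le_sum_abs _ _).trans (abs_le_of_sq_le_sq' hfin (by positivity)).2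

/-- The covariance inequality for `φ`-mixing σ-algebras. -/
lemma abs_covariance_le_of_mixing {c : ℝ} (h₁ : m₁ ≤ mΩ) (h₂ : m₂ ≤ mΩ) (hc : 0 ≤ c)
    (hmix : ∀ A B, MeasurableSet[m₁] A → MeasurableSet[m₂] B →
      |μ.real (A ∩ B) - μ.real A * μ.real B| ≤ c * μ.real A)
    {X Y : Ω → ℝ} (hX : Measurable[m₁] X) (hY : Measurable[m₂] Y)
    (hX2 : MemLp X 2 μ) (hY2 : MemLp Y 2 μ) :
    |∫ ω, X ω * Y ω ∂μ - (∫ ω, X ω ∂μ) * ∫ ω, Y ω ∂μ| ≤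
      2 * √c * (√(∫ ω, X ω ^ 2 ∂μ) * √(∫ ω, Y ω ^ 2 ∂μ)) := by
  obtain ⟨U, hUm, hUf, hUb, hUt⟩ := exists_approx_mem_finset hX
  obtain ⟨V, hVm, hVf, hVb, hVt⟩ := exists_approx_mem_finset hY
  have hU' : ∀ n, Measurable (U n) := fun n => (hUm n).mono h₁ le_rfl
  have hV' : ∀ n, Measurable (V n) := fun n => (hVm n).mono h₂ le_rfl
  have hsq : ∀ {W : Ω → ℝ} {T : ℕ → Ω → ℝ}, MemLp W 2 μ → (∀ n, Measurable (T n)) →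
      (∀ n ω, |T n ω| ≤ 2 * |W ω|) → (∀ ω, Tendsto (fun n => T n ω) atTop (𝓝 (W ω))) →
      Tendsto (fun n => ∫ ω, T n ω ∂μ) atTop (𝓝 (∫ ω, W ω ∂μ)) ∧
      Tendsto (fun n => ∫ ω, T n ω ^ 2 ∂μ) atTop (𝓝 (∫ ω, W ω ^ 2 ∂μ)) := by
    intro W T hW hTm hTb hTt
    constructor
    · refine tendsto_integral_of_dominated_convergence (fun ω => 2 * |W ω|)
        (fun n => (hTm n).aestronglyMeasurable) ?_ (fun n => ae_of_all _ fun ω => hTb n ω)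
        (ae_of_all _ hTt)
      exact ((hW.integrable one_le_two).abs).const_mul 2
    · refine tendsto_integral_of_dominated_convergence (fun ω => 4 * W ω ^ 2)
        (fun n => ((hTm n).pow_const 2).aestronglyMeasurable) (hW.integrable_sq.const_mul 4)
        (fun n => ae_of_all _ fun ω => ?_) (ae_of_all _ fun ω => (hTt ω).pow 2)
      rw [Real.norm_eq_abs, abs_of_nonneg (sq_nonneg _), ← sq_abs (T n ω), ← sq_abs (W ω)]
      nlinarith [hTb n ω, abs_nonneg (T n ω), abs_nonneg (W ω)]
  obtain ⟨hU1, hU2⟩ := hsq hX2 hU' hUb hUt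
  obtain ⟨hV1, hV2⟩ := hsq hY2 hV' hVb hVt
  have hUV : Tendsto (fun n => ∫ ω, U n ω * V n ω ∂μ) atTop (𝓝 (∫ ω, X ω * Y ω ∂μ)) := by
    refine tendsto_integral_of_dominated_convergence (fun ω => 4 * |X ω * Y ω|)
      (fun n => ((hU' n).mul (hV' n)).aestronglyMeasurable)
      ((hX2.integrable_mul hY2).abs.const_mul 4) (fun n => ae_of_all _ fun ω => ?_)
      (ae_of_all _ fun ω => (hUt ω).mul (hVt ω))
    rw [Real.norm_eq_abs, abs_mul, abs_mul]
    nlinarith [mul_le_mul (hUb n ω) (hVb n ω) (abs_nonneg _) (by positivity)]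
  refine le_of_tendsto_of_tendsto' (hUV.sub (hU1.mul hV1)).abs
    (((hU2.sqrt).mul (hV2.sqrt)).const_mul (2 * √c)) fun n => ?_
  obtain ⟨s, hs⟩ := hUf n
  obtain ⟨t, ht⟩ := hVf n
  exact abs_covariance_le_of_mem_finset h₁ h₂ hc hmix (hUm n) (hVm n) hs ht

end MixingCovariance

/-! ### Summability and semidefiniteness of the long-run covariance. -/

section LongRunCovariance

variable {N : ℕ} {Ω : Type*} [mΩ : MeasurableSpace Ω] {μ : Measure Ω}
  {ξ : ℕ → Ω → EuclideanSpace ℝ (Fin N)} {φ : ℕ → ℝ}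

lemma IsStationaryProcess.integral_mul_eq (h : IsStationaryProcess ξ μ) (a k : ℕ)
    (i j : Fin N) : ∫ ω, ξ a ω i * ξ (a + k) ω j ∂μ = ∫ ω, ξ 0 ω i * ξ k ω j ∂μ := by
  have hF : Measurable fun f : ℕ → EuclideanSpace ℝ (Fin N) => f 0 i * f k j := by fun_prop
  have := ((h a).comp hF).integral_eq
  simpa only [Function.comp_def, zero_add, add_comm k a] using this

lemma memLp_apply {X : Ω → EuclideanSpace ℝ (Fin N)} (hX : MemLp X 2 μ) (i : Fin N) :
    MemLp (fun ω => X ω i) 2 μ :=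
  (EuclideanSpace.proj (𝕜 := ℝ) i).comp_memLp' hX

lemma IsPhiMixing.nonneg [IsProbabilityMeasure μ] (h : IsPhiMixing ξ μ φ) (j : ℕ) : 0 ≤ φ j := by
  have := h 0 j Set.univ Set.univ MeasurableSet.univ MeasurableSet.univ
  simpa using this

/-- The autocovariances of a stationary, centred, square integrable, `φ`-mixing sequence with
`∑ √φ < ∞` are summable. -/
lemma IsPhiMixing.summable_autocovariance [IsProbabilityMeasure μ] (hmix : IsPhiMixing ξ μ φ)
    (hmeas : ∀ k, Measurable (ξ k)) (hL2 : ∀ k, MemLp (ξ k) 2 μ)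
    (hmean : ∀ k, ∫ ω, ξ k ω ∂μ = 0) (hstat : IsStationaryProcess ξ μ)
    (hφ : Summable fun j => √(φ j)) (i j : Fin N) :
    Summable fun k : ℕ => ∫ ω, ξ 0 ω i * ξ (k + 1) ω j ∂μ := by
  have hbound : ∀ k : ℕ, ‖∫ ω, ξ 0 ω i * ξ (k + 1) ω j ∂μ‖ ≤
      2 * √(φ (k + 1)) * (√(∫ ω, ξ 0 ω i ^ 2 ∂μ) * √(∫ ω, ξ 0 ω j ^ 2 ∂μ)) := by
    intro k
    have hle : ∀ I : ℕ → Prop, (⨆ n, ⨆ (_ : I n), MeasurableSpace.comap (ξ n) inferInstance) ≤ mΩ :=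
      fun I => iSup₂_le fun n _ => (hmeas n).comap_le
    have hcoord : ∀ l : Fin N, Measurable fun x : EuclideanSpace ℝ (Fin N) => x l := fun l => by
      fun_prop
    have hX : Measurable[⨆ n, ⨆ (_ : n ≤ 0), MeasurableSpace.comap (ξ n) inferInstance]
        fun ω => ξ 0 ω i :=
      (hcoord i).comp ((comap_measurable (ξ 0)).mono
        (le_iSup₂_of_le 0 le_rfl le_rfl) le_rfl)
    have hY : Measurable[⨆ n, ⨆ (_ : 0 + (k + 1) ≤ n), MeasurableSpace.comap (ξ n) inferInstance]
        fun ω => ξ (k + 1) ω j :=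
      (hcoord j).comp ((comap_measurable (ξ (k + 1))).mono
        (le_iSup₂_of_le (k + 1) (by omega) le_rfl) le_rfl)
    have h := abs_covariance_le_of_mixing (hle _) (hle _) (hmix.nonneg (k + 1))
      (hmix 0 (k + 1)) hX hY (memLp_apply (hL2 0) i) (memLp_apply (hL2 (k + 1)) j)
    have hmean0 : ∫ ω, ξ 0 ω i ∂μ = 0 := by
      have := (EuclideanSpace.proj (𝕜 := ℝ) i).integral_comp_comm ((hL2 0).integrable one_le_two)
      rw [hmean 0, map_zero] at this
      exact this
    -- Stationarity leaves `√(φ (k + 1))` as the only dependence of the bound on `k`.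
    have hvar : ∫ ω, ξ (k + 1) ω j ^ 2 ∂μ = ∫ ω, ξ 0 ω j ^ 2 ∂μ := by
      have := hstat.integral_mul_eq (k + 1) 0 j j
      simpa only [add_zero, ← sq] using this
    rwa [hmean0, zero_mul, sub_zero, hvar] at h
  refine Summable.of_norm_bounded ?_ hbound
  exact (((summable_nat_add_iff 1).2 hφ).mul_left 2).mul_right _

/-- The long-run covariance matrix of a stationary sequence with summable autocovariances is
positive semidefinite. -/
lemma posSemidef_longRunCovariance (hL2 : ∀ k, MemLp (ξ k) 2 μ) (hstat : IsStationaryProcess ξ μ)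
    (hsum : ∀ i j, Summable fun k : ℕ => ∫ ω, ξ 0 ω i * ξ (k + 1) ω j ∂μ) :
    (longRunCovariance ξ μ).PosSemidef := by
  have hswap : ∀ (k : ℕ) (i j : Fin N),
      ∫ ω, ξ (k + 1) ω i * ξ 0 ω j ∂μ = ∫ ω, ξ 0 ω j * ξ (k + 1) ω i ∂μ :=
    fun k i j => integral_congr_ae (ae_of_all _ fun ω => mul_comm _ _)
  have hswap0 : ∀ i j : Fin N, ∫ ω, ξ 0 ω i * ξ 0 ω j ∂μ = ∫ ω, ξ 0 ω j * ξ 0 ω i ∂μ :=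
    fun i j => integral_congr_ae (ae_of_all _ fun ω => mul_comm _ _)
  refine Matrix.PosSemidef.of_dotProduct_mulVec_nonneg ?_ fun x => ?_
  · ext i j
    simp only [longRunCovariance, Matrix.conjTranspose_apply, Matrix.of_apply, star_trivial]
    simp_rw [hswap]
    rw [hswap0 j i]
    ring
  rw [star_trivial]
  set V : ℕ → Ω → ℝ := fun k ω => ∑ i, x i * ξ k ω i with hV
  have hVL : ∀ k, MemLp (V k) 2 μ := fun k =>
    memLp_finsetSum _ fun i _ => (memLp_apply (hL2 k) i).const_mul (x i)
  have hVV : ∀ a k, ∫ ω, V a ω * V (a + k) ω ∂μ =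
      ∑ i, ∑ j, x i * x j * ∫ ω, ξ 0 ω i * ξ k ω j ∂μ := by
    intro a k
    have hint : ∀ i j, Integrable (fun ω => x i * x j * (ξ a ω i * ξ (a + k) ω j)) μ :=
      fun i j => ((memLp_apply (hL2 a) i).integrable_mul (memLp_apply (hL2 (a + k)) j)).const_mul _
    have hpt : ∀ ω, V a ω * V (a + k) ω = ∑ i, ∑ j, x i * x j * (ξ a ω i * ξ (a + k) ω j) := by
      intro ω
      simp only [hV, Finset.sum_mul_sum]
      exact Finset.sum_congr rfl fun i _ => Finset.sum_congr rfl fun j _ => by ring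
    simp_rw [hpt]
    rw [integral_finsetSum _ fun i _ => integrable_finsetSum _ fun j _ => hint i j]
    refine Finset.sum_congr rfl fun i _ => ?_
    rw [integral_finsetSum _ fun j _ => hint i j]
    refine Finset.sum_congr rfl fun j _ => ?_
    rw [integral_const_mul, hstat.integral_mul_eq]
  set γ : ℕ → ℝ := fun k => ∑ i, ∑ j, x i * x j * ∫ ω, ξ 0 ω i * ξ k ω j ∂μ with hγ
  -- `g n` is the growth of the variance of the partial sums of `V` from `n` to `n + 1` terms, and
  -- it tends to the form of the long-run covariance at `x`.
  set g : ℕ → ℝ := fun n => γ 0 + 2 * ∑ k ∈ Finset.range n, γ (k + 1) with hg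
  have hquad : ∀ n, ∑ a ∈ Finset.range n, g a = ∫ ω, (∑ k ∈ Finset.range n, V k ω) ^ 2 ∂μ := by
    intro n
    induction n with
    | zero => simp
    | succ n ih =>
      have hSL : MemLp (fun ω => ∑ k ∈ Finset.range n, V k ω) 2 μ :=
        memLp_finsetSum _ fun k _ => hVL k
      have hcross : ∫ ω, (∑ k ∈ Finset.range n, V k ω) * V n ω ∂μ =
          ∑ k ∈ Finset.range n, γ (k + 1) := by
        have hint : ∀ k, Integrable (fun ω => V k ω * V n ω) μ := fun k =>
          (hVL k).integrable_mul (hVL n)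
        simp_rw [Finset.sum_mul]
        rw [integral_finsetSum _ fun k _ => hint k, ← Finset.sum_range_reflect]
        refine Finset.sum_congr rfl fun k hk => ?_
        have hk := Finset.mem_range.1 hk
        -- After the reflection the first factor has index `n - 1 - k`, so its lag to `n` is `k +
        -- 1`.
        rw [show V n = V ((n - 1 - k) + (k + 1)) by congr 1; omega]
        exact hVV _ _
      have hsq : ∫ ω, V n ω ^ 2 ∂μ = γ 0 := by
        simpa only [add_zero, ← sq] using hVV n 0
      rw [Finset.sum_range_succ, ih]
      simp_rw [Finset.sum_range_succ, add_sq, mul_assoc (2 : ℝ)]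
      have hi1 : Integrable (fun ω => (∑ k ∈ Finset.range n, V k ω) ^ 2) μ := hSL.integrable_sq
      have hi2 : Integrable (fun ω => 2 * ((∑ k ∈ Finset.range n, V k ω) * V n ω)) μ :=
        (hSL.integrable_mul (hVL n)).const_mul 2
      have hi12 : Integrable (fun ω => (∑ k ∈ Finset.range n, V k ω) ^ 2 +
          2 * ((∑ k ∈ Finset.range n, V k ω) * V n ω)) μ := hi1.add hi2
      rw [integral_add hi12 (hVL n).integrable_sq, integral_add hi1 hi2, integral_const_mul,
        hcross, hsq]
      simp only [hg]
      ring
  have hlim : Tendsto g atTop (𝓝 (x ⬝ᵥ longRunCovariance ξ μ *ᵥ x)) := by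
    have hval : x ⬝ᵥ longRunCovariance ξ μ *ᵥ x = ∑ i, ∑ j, x i * x j *
        ((∫ ω, ξ 0 ω i * ξ 0 ω j ∂μ) + (∑' k : ℕ, ∫ ω, ξ 0 ω i * ξ (k + 1) ω j ∂μ)
          + (∑' k : ℕ, ∫ ω, ξ 0 ω j * ξ (k + 1) ω i ∂μ)) := by
      simp only [dotProduct, Matrix.mulVec, longRunCovariance, Matrix.of_apply, Finset.mul_sum,
        hswap]
      exact Finset.sum_congr rfl fun i _ => Finset.sum_congr rfl fun j _ => by ring
    have hpart : ∀ n, g n = ∑ i, ∑ j, x i * x j * ((∫ ω, ξ 0 ω i * ξ 0 ω j ∂μ) +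
        (∑ k ∈ Finset.range n, ∫ ω, ξ 0 ω i * ξ (k + 1) ω j ∂μ)
          + (∑ k ∈ Finset.range n, ∫ ω, ξ 0 ω j * ξ (k + 1) ω i ∂μ)) := by
      intro n
      have e1 : ∑ k ∈ Finset.range n, γ (k + 1) = ∑ i, ∑ j, x i * x j *
          ∑ k ∈ Finset.range n, ∫ ω, ξ 0 ω i * ξ (k + 1) ω j ∂μ := by
        simp only [hγ, Finset.mul_sum]
        rw [Finset.sum_comm]
        exact Finset.sum_congr rfl fun i _ => Finset.sum_comm
      have e2 : ∑ k ∈ Finset.range n, γ (k + 1) = ∑ i, ∑ j, x i * x j *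
          ∑ k ∈ Finset.range n, ∫ ω, ξ 0 ω j * ξ (k + 1) ω i ∂μ := by
        rw [e1, Finset.sum_comm]
        exact Finset.sum_congr rfl fun i _ => Finset.sum_congr rfl fun j _ => by ring
      simp only [mul_add, Finset.sum_add_distrib]
      rw [← e1, ← e2]
      simp only [hg, hγ]
      ring
    rw [hval]
    simp_rw [funext hpart]
    exact tendsto_finsetSum _ fun i _ => tendsto_finsetSum _ fun j _ => Tendsto.const_mul _
      ((tendsto_const_nhds.add (hsum i j).hasSum.tendsto_sum_nat).add
        (hsum j i).hasSum.tendsto_sum_nat)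
  -- The Cesàro means of `g` have the same limit, and they are normalized second moments, hence
  -- nonnegative.
  refine ge_of_tendsto' hlim.cesaro fun n => ?_
  rw [hquad]
  exact mul_nonneg (by positivity) (integral_nonneg fun ω => sq_nonneg _)

end LongRunCovariance

/-! ### The main theorem. -/

/-- The diffusion coefficient enters the transition law only through `S Sᵀ`, so this is all that is
needed of the square root. -/
lemma psdSqrt_mul_transpose {N : ℕ} {M : Matrix (Fin N) (Fin N) ℝ} (hM : M.PosSemidef) :
    psdSqrt M * (psdSqrt M)ᵀ = M := by
  open scoped MatrixOrder in
  have h : (psdSqrt M).PosSemidef := Matrix.nonneg_iff_posSemidef.1 (CFC.sqrt_nonneg M)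
  have ht : (psdSqrt M)ᵀ = psdSqrt M := by simpa using h.isHermitian.eq
  rw [ht]
  open scoped MatrixOrder in
  exact CFC.sqrt_mul_sqrt_self M (Matrix.nonneg_iff_posSemidef.2 hM)

theorem corollary2 {N : ℕ}
    -- the cost function and the point at which it is linearized
    (C : EuclideanSpace ℝ (Fin N) → ℝ) (hC : ContDiff ℝ 2 C)
    (αstar : EuclideanSpace ℝ (Fin N))
    (hpos : (hessianMatrix C αstar).PosDef)
    -- the stationary, centred, square integrable mixing noise
    {Ω₀ : Type*} [MeasurableSpace Ω₀] (μ₀ : Measure Ω₀) [IsProbabilityMeasure μ₀]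
    (ξbar : ℕ → Ω₀ → EuclideanSpace ℝ (Fin N)) (φ : ℕ → ℝ)
    (hmeas : ∀ k, Measurable (ξbar k))
    (hL2 : ∀ k, MemLp (ξbar k) 2 μ₀)
    (hmean : ∀ k, ∫ ω, ξbar k ω ∂μ₀ = 0)
    (hstat : IsStationaryProcess ξbar μ₀)
    (hmix : IsPhiMixing ξbar μ₀ φ)
    (hφ : Summable fun j => √(φ j)) :
    -- the series that define the covariance converge absolutely and give a covariance matrix
    (∀ i j, Summable fun k : ℕ => ∫ ω, ξbar 0 ω i * ξbar (k + 1) ω j ∂μ₀) ∧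
    (longRunCovariance ξbar μ₀).PosSemidef ∧
    ∃ P : Matrix (Fin N) (Fin N) ℝ,
      -- `P` is a covariance matrix and the unique solution of the Lyapunov equation
      P.PosSemidef ∧
      hessianMatrix C αstar * P + P * hessianMatrix C αstar = longRunCovariance ξbar μ₀ ∧
      (∀ Q : Matrix (Fin N) (Fin N) ℝ,
        hessianMatrix C αstar * Q + Q * hessianMatrix C αstar = longRunCovariance ξbar μ₀ →
          Q = P) ∧
      -- the diffusion exists for each Brownian motion and each initial value
      (∀ (Ω : Type*) [mΩ : MeasurableSpace Ω] (μ : Measure Ω) [IsProbabilityMeasure μ]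
        (ℱ : Filtration ℝ≥0 mΩ) (w : ℝ≥0 → Ω → EuclideanSpace ℝ (Fin N))
        (η : Ω → EuclideanSpace ℝ (Fin N)),
        IsStandardBrownianMotion μ ℱ w → Measurable[ℱ 0] η →
          ∃ u : ℝ≥0 → Ω → EuclideanSpace ℝ (Fin N),
            IsLinearSDESolution μ ℱ (hessianMatrix C αstar)
              (psdSqrt (longRunCovariance ξbar μ₀)) w u ∧ u 0 =ᵐ[μ] η) ∧
      -- started from `N(0, P)` it is strictly stationary with marginals `N(0, P)`
      (∀ (Ω : Type*) [mΩ : MeasurableSpace Ω] (μ : Measure Ω) [IsProbabilityMeasure μ]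
        (ℱ : Filtration ℝ≥0 mΩ) (w u : ℝ≥0 → Ω → EuclideanSpace ℝ (Fin N)),
        IsLinearSDESolution μ ℱ (hessianMatrix C αstar)
          (psdSqrt (longRunCovariance ξbar μ₀)) w u →
        HasLaw (u 0) (multivariateGaussian 0 P) μ →
          IsStationaryProcess u μ ∧ ∀ t, HasLaw (u t) (multivariateGaussian 0 P) μ) ∧
      -- from any initial law, its asymptotic marginal distribution is `N(0, P)`, and its
      -- shifts converge to the stationary version in finite-dimensional distributions
      (∀ (Ω : Type*) [mΩ : MeasurableSpace Ω] (μ : Measure Ω) [IsProbabilityMeasure μ]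
        (ℱ : Filtration ℝ≥0 mΩ) (w u : ℝ≥0 → Ω → EuclideanSpace ℝ (Fin N)),
        IsLinearSDESolution μ ℱ (hessianMatrix C αstar)
          (psdSqrt (longRunCovariance ξbar μ₀)) w u →
        TendstoInDistribution u atTop id (fun _ => μ) (multivariateGaussian 0 P) ∧
        ∀ (Ω' : Type*) [mΩ' : MeasurableSpace Ω'] (μ' : Measure Ω') [IsProbabilityMeasure μ']
          (ℱ' : Filtration ℝ≥0 mΩ') (w' v : ℝ≥0 → Ω' → EuclideanSpace ℝ (Fin N)),
          IsLinearSDESolution μ' ℱ' (hessianMatrix C αstar)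
            (psdSqrt (longRunCovariance ξbar μ₀)) w' v →
          HasLaw (v 0) (multivariateGaussian 0 P) μ' →
          ∀ (n : ℕ) (τ : Fin n → ℝ≥0),
            TendstoInDistribution (fun (s : ℝ≥0) ω (i : Fin n) => u (τ i + s) ω) atTop
              (fun ω i => v (τ i) ω) (fun _ => μ) μ') := by
  have hsum := hmix.summable_autocovariance hmeas hL2 hmean hstat hφ
  have hcov := posSemidef_longRunCovariance hL2 hstat hsum
  obtain ⟨P, hP⟩ := hpos.exists_lyapunov (longRunCovariance ξbar μ₀)
  have hPs := hpos.lyapunov_posSemidef hcov hP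
  have hPS := hP.trans (psdSqrt_mul_transpose hcov).symm
  refine ⟨hsum, hcov, P, hPs, hP, fun Q hQ => hpos.lyapunov_unique hP hQ, ?_, ?_, ?_⟩
  · intro Ω mΩ μ _ ℱ w η hw hη
    exact hw.exists_isLinearSDESolution hpos.isHermitian _ hη
  · intro Ω mΩ μ _ ℱ w u hu h0
    exact ⟨hu.isStationaryProcess hpos.isHermitian hPs hPS h0,
      hu.hasLaw hpos.isHermitian hPs hPS h0⟩
  · intro Ω mΩ μ _ ℱ w u hu
    refine ⟨hu.tendstoInDistribution hpos hPs hPS, ?_⟩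
    intro Ω' mΩ' μ' _ ℱ' w' v hv h0 n τ
    exact hu.tendstoInDistribution_shift hv hpos hPs hPS h0 τ
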